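/- Let $T\ge 1$, $d\in\mathbb N_0$, $N\in\mathbb N$, $N\geq 1$. Let $(\Omega,\mathcal A,\mathbb P)$ be a complete probability space with a filtration $(\mathcal F_t)_{t\ge0}$ satisfying the usual conditions and a standard $\mathbb R^d$-valued Wiener process $W$ for $(\mathcal F_t)_{t\ge 0}$. For $p\in[2,\infty)$ and $m\in\mathbb N_0$ let $\mathcal C^{m,p}$ be the normed space of all $\mathcal F$-adapted processes $X\in L^p(\Omega,C([0,T],\mathbb R^m))$ with norm $\mathbb E[\sup_{t\in[0,T]}\|X_t\|^p]^{1/p}$, and identify $\mathcal C^{d,p}\times\mathcal C^{d,p}$ with $\mathcal C^{2d,p}$. For coefficients $b\colon[0,T]\times\mathbb R^m\to\mathbb R^m$ and $s\colon[0,T]\times\mathbb R^m\to\mathbb R^{m\times d}$ and $t_n=nT/N$, the Euler scheme $\mathcal E^N_{b,s}(x)$, $x\in\mathbb R^m$, is the process with $\mathcal E^N_{b,s}(x)_0=x$ and, for $0\le n<N$ and $t\in[t_n,t_{n+1}]$, $$\mathcal E^N_{b,s}(x)_t=\mathcal E^N_{b,s}(x)_{t_n}+b(t_n,\mathcal E^N_{b,s}(x)_{t_n})(t-t_n)+s(t_n,\mathcal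 E^N_{b,s}(x)_{t_n})(W_t-W_{t_n}).$$ For a Fréchet differentiable map $h\colon B_1\to B_2$ between normed spaces, its augmented derivative is $\hat h\colon B_1\times B_1\to B_2\times B_2$, $\hat h(x_1,x_2)=(h(x_1),Dh_{x_1}(x_2))$; for time-dependent $h$, $\hat h(t,\cdot)$ is the augmented derivative of $h(t,\cdot)$. We identify $\mathbb R^d\times\mathbb R^d$ with $\mathbb R^{2d}$ and $\mathbb R^{d\times d}\times\mathbb R^{d\times d}$ with $\mathbb R^{2d\times d}$ (stacking the matrices). **Proposition.** Let $\mu\colon[0,T]\times\mathbb R^d\to\mathbb R^d$ and $\sigma\colon[0,T]\times\mathbb R^d\to\mathbb R^{d\times d}$ be continuous in time and continuously differentiable in space, with spatial derivatives that are globally bounded uniformly in time. Then $\mathcal E^N_{\mu,\sigma}(x)\in\bigcap_{p\in[2,\infty)}\mathcal C^{d,p}$ for all $x\in\mathbb R^d$ and $\mathcal E^N_{\hat\mu,\hat\sigma}(z)\in\bigcap_{p\in[2,\infty)}\mathcal C^{2d,p}$ for all $z\in\mathbb R^{2d}$. For every $p\in[2,\infty)$, the map $\mathcal E^N_{\mu,\sigma}\colon\mathbb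 R^d\to\mathcal C^{d,p}$ is Fréchet differentiable, and its augmented derivative, regarded as a map $\mathbb R^{2d}\to\mathcal C^{2d,p}$, equals $\mathcal E^N_{\hat\mu,\hat\sigma}$. In particular, the augmented derivative of $\mathcal E^N_{\mu,\sigma}$ takes values in $\bigcap_{q\in[2,\infty)}\mathcal C^{2d,q}$ and does not depend on $p$. -/

import Mathlib

open MeasureTheory ProbabilityTheory
open scoped NNReal ENNReal Matrix

/- Spaces of matrices carry the Frobenius norm. -/
attribute [local instance] Matrix.frobeniusNormedAddCommGroup Matrix.frobeniusNormedSpace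

noncomputable section

/-! ### Augmented derivatives -/

/-- The augmented derivative `(x₁, x₂) ↦ (h x₁, D h_{x₁} (x₂))` of a map `h` between normed
spaces; meaningful when `h` is Fréchet differentiable. -/
def augDeriv {B₁ B₂ : Type*} [NormedAddCommGroup B₁] [NormedSpace ℝ B₁]
    [NormedAddCommGroup B₂] [NormedSpace ℝ B₂] (h : B₁ → B₂) : B₁ × B₁ → B₂ × B₂ :=
  fun z => (h z.1, fderiv ℝ h z.1 z.2)

/-- The augmented derivative (in space) of a drift coefficient, with `ℝᵈ × ℝᵈ` identified with
the Euclidean space `ℝ²ᵈ`. -/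
def augDrift {ι : Type*} [Fintype ι]
    (μ : ℝ≥0 → EuclideanSpace ℝ ι → EuclideanSpace ℝ ι) :
    ℝ≥0 → EuclideanSpace ℝ (ι ⊕ ι) → EuclideanSpace ℝ (ι ⊕ ι) :=
  fun t z => EuclideanSpace.sumEquivProd.symm (augDeriv (μ t) (EuclideanSpace.sumEquivProd z))

/-- The augmented derivative (in space) of a diffusion coefficient, with `ℝᵈ × ℝᵈ` identified with
`ℝ²ᵈ`, and with a pair of `d × k` matrices stacked to a `2d × k` matrix. -/
def augDiffusion {ι κ : Type*} [Fintype ι] [Fintype κ]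
    (σ : ℝ≥0 → EuclideanSpace ℝ ι → Matrix ι κ ℝ) :
    ℝ≥0 → EuclideanSpace ℝ (ι ⊕ ι) → Matrix (ι ⊕ ι) κ ℝ :=
  fun t z => Matrix.fromRows (augDeriv (σ t) (EuclideanSpace.sumEquivProd z)).1
    (augDeriv (σ t) (EuclideanSpace.sumEquivProd z)).2

/-! ### Assumptions on the coefficients -/

/-- On the time interval `[0, T]`, the function `h` is continuous in time and continuously
differentiable in space, with spatial derivatives bounded uniformly in time and space. -/
structure RegularCoefficient {B₁ B₂ : Type*} [NormedAddCommGroup B₁] [NormedSpace ℝ B₁]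
    [NormedAddCommGroup B₂] [NormedSpace ℝ B₂] (T : ℝ≥0) (h : ℝ≥0 → B₁ → B₂) : Prop where
  continuous_time : ∀ x, ContinuousOn (fun t => h t x) (Set.Icc 0 T)
  contDiff_space : ∀ t ∈ Set.Icc 0 T, ContDiff ℝ 1 (h t)
  bounded_deriv : ∃ C : ℝ, ∀ t ∈ Set.Icc 0 T, ∀ x, ‖fderiv ℝ (h t) x‖ ≤ C

/-! ### The stochastic basis -/

section Stochastic

variable {Ω : Type*} {mΩ : MeasurableSpace Ω}

/-- The usual conditions: `ℱ` is right-continuous and `ℱ 0` contains every `P`-null set (in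
particular, `P` is complete). -/
structure UsualConditions (P : Measure Ω) (ℱ : Filtration ℝ≥0 mΩ) : Prop where
  right_continuous : ∀ t, ⨅ s > t, ℱ s = ℱ t
  null_sets : ∀ s : Set Ω, P s = 0 → MeasurableSet[ℱ 0] s

/-- `W` is a standard Wiener process for the filtration `ℱ`. -/
structure IsWienerProcess {κ : Type*} [Fintype κ] (P : Measure Ω) (ℱ : Filtration ℝ≥0 mΩ)
    (W : ℝ≥0 → Ω → EuclideanSpace ℝ κ) : Prop where
  adapted : ∀ t, Measurable[ℱ t] (W t)
  zero : ∀ᵐ ω ∂P, W 0 ω = 0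
  law_increment : ∀ s t, s ≤ t → P.map (fun ω => W t ω - W s ω) =
    (stdGaussian (EuclideanSpace ℝ κ)).map (fun x => √((t : ℝ) - s) • x)
  indep_increment : ∀ s t, s ≤ t →
    Indep (MeasurableSpace.comap (fun ω => W t ω - W s ω) inferInstance) (ℱ s) P
  continuous_paths : ∀ᵐ ω ∂P, Continuous fun t => W t ω

/-! ### The spaces of adapted continuous `L^p` processes on `[0, T]` -/

variable {T : ℝ≥0} {V V₁ V₂ : Type*} [NormedAddCommGroup V] [NormedSpace ℝ V]
  [NormedAddCommGroup V₁] [NormedSpace ℝ V₁] [NormedAddCommGroup V₂] [NormedSpace ℝ V₂]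
  {P : Measure Ω} {ℱ : Filtration ℝ≥0 mΩ} {p : ℝ≥0∞}

/-- The space of all `X ∈ L^p(Ω, C([0, T], V))` that are `ℱ`-adapted. Elements of `L^p` are classes
of almost everywhere equal functions, so "adapted" is read as: `X t` is almost everywhere equal to
an `ℱ t`-measurable function. The norm, inherited from `L^p`, is `E[sup_t ‖X t‖ ^ p] ^ (1 / p)`. -/
def CAd (P : Measure Ω) (ℱ : Filtration ℝ≥0 mΩ) (T : ℝ≥0) (V : Type*) [NormedAddCommGroup V]
    [NormedSpace ℝ V] (p : ℝ≥0∞) : Submodule ℝ (Lp C(Set.Icc 0 T, V) p P) where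
  carrier := {X | ∀ t : Set.Icc 0 T, AEStronglyMeasurable[ℱ t] (fun ω => X ω t) P}
  zero_mem' t := by
    refine ⟨fun _ => 0, stronglyMeasurable_const, ?_⟩
    filter_upwards [Lp.coeFn_zero C(Set.Icc 0 T, V) p P] with ω h
    exact congrArg (fun f : C(Set.Icc 0 T, V) => f t) h
  add_mem' {X Y} hX hY t := by
    refine ((hX t).add (hY t)).congr ?_
    filter_upwards [Lp.coeFn_add X Y] with ω h
    exact (congrArg (fun f : C(Set.Icc 0 T, V) => f t) h).symm
  smul_mem' c X hX t := by
    refine ((hX t).const_smul c).congr ?_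
    filter_upwards [Lp.coeFn_smul c X] with ω h
    exact (congrArg (fun f : C(Set.Icc 0 T, V) => f t) h).symm

open Classical in
/-- The path `t ↦ X t ω` of a process on `[0, T]`, as an element of `C([0, T], V)` (and `0` on the
exceptional event on which the path is not continuous). -/
def pathOf (X : Set.Icc 0 T → Ω → V) (ω : Ω) : C(Set.Icc 0 T, V) :=
  if h : Continuous fun t => X t ω then ⟨fun t => X t ω, h⟩ else 0

/-- The process `X` on `[0, T]` is almost surely continuous, `ℱ`-adapted, and the norm
`E[sup_t ‖X t‖ ^ p] ^ (1 / p)` is finite. -/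
structure MemCAd (P : Measure Ω) (ℱ : Filtration ℝ≥0 mΩ) (p : ℝ≥0∞)
    (X : Set.Icc 0 T → Ω → V) : Prop where
  continuous_paths : ∀ᵐ ω ∂P, Continuous fun t => X t ω
  adapted : ∀ t : Set.Icc 0 T, StronglyMeasurable[ℱ t] (X t)
  memLp : MemLp (pathOf X) p P

/-- The process `X` belongs to the `L^p` space of adapted continuous processes for every
`p ∈ [2, ∞)`. -/
def MemEInf (P : Measure Ω) (ℱ : Filtration ℝ≥0 mΩ) (X : Set.Icc 0 T → Ω → V) : Prop :=
  ∀ p : ℝ≥0∞, 2 ≤ p → p ≠ ∞ → MemCAd P ℱ p X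

/-- The element of `CAd` given by a process. -/
def CAd.mk (X : Set.Icc 0 T → Ω → V) (hX : MemCAd P ℱ p X) : CAd P ℱ T V p :=
  ⟨hX.memLp.toLp (pathOf X), fun t => ⟨X t, hX.adapted t, by
    filter_upwards [hX.memLp.coeFn_toLp, hX.continuous_paths] with ω h h'
    simp [h, pathOf, h']⟩⟩

/-- A family of processes indexed by `x : B`, as a map from `B` to `CAd`. -/
def CAd.mkMap {B : Type*} (X : B → Set.Icc 0 T → Ω → V) (hX : ∀ x, MemEInf P ℱ (X x))
    (p : ℝ≥0∞) (hp : 2 ≤ p) (hp' : p ≠ ∞) : B → CAd P ℱ T V p :=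
  fun x => CAd.mk (X x) (hX x p hp hp')

/-- A continuous linear map `L : V₁ → V₂`, applied at every time to the elements of `CAd`. -/
def CAd.map [Fact (1 ≤ p)] (L : V₁ →L[ℝ] V₂) : CAd P ℱ T V₁ p →L[ℝ] CAd P ℱ T V₂ p :=
  (((L.compLeftContinuous ℝ (Set.Icc 0 T)).compLpL p P).comp
    (CAd P ℱ T V₁ p).subtypeL).codRestrict (CAd P ℱ T V₂ p) (fun X t => by
      refine (L.continuous.comp_aestronglyMeasurable (X.2 t)).congr ?_
      filter_upwards [(L.compLeftContinuous ℝ (Set.Icc 0 T)).coeFn_compLpL X.1] with ω h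
      exact (congrArg (fun f : C(Set.Icc 0 T, V₂) => f t) h).symm)

theorem CAd.coeFn_map [Fact (1 ≤ p)] (L : V₁ →L[ℝ] V₂) (X : CAd P ℱ T V₁ p) :
    ∀ᵐ ω ∂P, ∀ t, (CAd.map L X).1 ω t = L (X.1 ω t) := by
  filter_upwards [(L.compLeftContinuous ℝ (Set.Icc 0 T)).coeFn_compLpL X.1] with ω h t
  exact congrArg (fun f : C(Set.Icc 0 T, V₂) => f t) h

theorem CAd.ext_ae {X Y : CAd P ℱ T V p} (h : ∀ᵐ ω ∂P, ∀ t, X.1 ω t = Y.1 ω t) : X = Y := by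
  refine Subtype.ext (Lp.ext ?_)
  filter_upwards [h] with ω hω
  exact ContinuousMap.ext hω

theorem CAd.coeFn_add (X Y : CAd P ℱ T V p) :
    ∀ᵐ ω ∂P, ∀ t, (X + Y).1 ω t = X.1 ω t + Y.1 ω t := by
  filter_upwards [Lp.coeFn_add X.1 Y.1] with ω h t
  exact congrArg (fun f : C(Set.Icc 0 T, V) => f t) h

/-- An identification of `V` with `V₁ × V₂` induces the identification of the space of `V`-valued
processes with the product of the spaces of `V₁`-valued and of `V₂`-valued processes, through
`Z ↦ (X, Y)` with `(X t, Y t) = e (Z t)`. -/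
def CAd.prodEquiv [Fact (1 ≤ p)] (e : V ≃L[ℝ] V₁ × V₂) :
    CAd P ℱ T V p ≃L[ℝ] CAd P ℱ T V₁ p × CAd P ℱ T V₂ p :=
  ContinuousLinearEquiv.equivOfInverse
    ((CAd.map ((ContinuousLinearMap.fst ℝ V₁ V₂).comp (e : V →L[ℝ] V₁ × V₂))).prod
      (CAd.map ((ContinuousLinearMap.snd ℝ V₁ V₂).comp (e : V →L[ℝ] V₁ × V₂))))
    ((CAd.map ((e.symm : V₁ × V₂ →L[ℝ] V).comp (ContinuousLinearMap.inl ℝ V₁ V₂))).coprod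
      (CAd.map ((e.symm : V₁ × V₂ →L[ℝ] V).comp (ContinuousLinearMap.inr ℝ V₁ V₂))))
    (fun Z => by
      refine CAd.ext_ae ?_
      let X : CAd P ℱ T V₁ p :=
        CAd.map ((ContinuousLinearMap.fst ℝ V₁ V₂).comp (e : V →L[ℝ] V₁ × V₂)) Z
      let Y : CAd P ℱ T V₂ p :=
        CAd.map ((ContinuousLinearMap.snd ℝ V₁ V₂).comp (e : V →L[ℝ] V₁ × V₂)) Z
      let A : V₁ →L[ℝ] V := (e.symm : V₁ × V₂ →L[ℝ] V).comp (ContinuousLinearMap.inl ℝ V₁ V₂)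
      let B : V₂ →L[ℝ] V := (e.symm : V₁ × V₂ →L[ℝ] V).comp (ContinuousLinearMap.inr ℝ V₁ V₂)
      filter_upwards [CAd.coeFn_add (CAd.map A X) (CAd.map B Y), CAd.coeFn_map A X,
        CAd.coeFn_map B Y,
        CAd.coeFn_map ((ContinuousLinearMap.fst ℝ V₁ V₂).comp (e : V →L[ℝ] V₁ × V₂)) Z,
        CAd.coeFn_map ((ContinuousLinearMap.snd ℝ V₁ V₂).comp (e : V →L[ℝ] V₁ × V₂)) Z] with ω h h1 h2 h3 h4 t
      refine (h t).trans ?_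
      rw [h1, h2, h3, h4]
      simp [A, B, ← map_add])
    (fun XY => by
      let A : V₁ →L[ℝ] V := (e.symm : V₁ × V₂ →L[ℝ] V).comp (ContinuousLinearMap.inl ℝ V₁ V₂)
      let B : V₂ →L[ℝ] V := (e.symm : V₁ × V₂ →L[ℝ] V).comp (ContinuousLinearMap.inr ℝ V₁ V₂)
      let Z : CAd P ℱ T V p := CAd.map A XY.1 + CAd.map B XY.2
      refine Prod.ext (CAd.ext_ae ?_) (CAd.ext_ae ?_)
      · filter_upwards [CAd.coeFn_map ((ContinuousLinearMap.fst ℝ V₁ V₂).comp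
            (e : V →L[ℝ] V₁ × V₂)) Z, CAd.coeFn_add (CAd.map A XY.1) (CAd.map B XY.2),
          CAd.coeFn_map A XY.1, CAd.coeFn_map B XY.2] with ω h h1 h2 h3 t
        refine (h t).trans ?_
        rw [h1, h2, h3]
        simp [A, B]
      · filter_upwards [CAd.coeFn_map ((ContinuousLinearMap.snd ℝ V₁ V₂).comp
            (e : V →L[ℝ] V₁ × V₂)) Z, CAd.coeFn_add (CAd.map A XY.1) (CAd.map B XY.2),
          CAd.coeFn_map A XY.1, CAd.coeFn_map B XY.2] with ω h h1 h2 h3 t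
        refine (h t).trans ?_
        rw [h1, h2, h3]
        simp [A, B])

/-! ### The Euler scheme -/

variable {ι κ : Type*} [Fintype ι] [Fintype κ]

/-- The uniform grid points `t_n = n T / N`. -/
def gridTime (T : ℝ≥0) (N n : ℕ) : ℝ≥0 := n * T / N

/-- The values `E_{t_n}` of the Euler scheme at the grid points:
`E_{t_{n+1}} = E_{t_n} + μ(t_n, E_{t_n}) (t_{n+1} - t_n) + σ(t_n, E_{t_n}) (W_{t_{n+1}} - W_{t_n})`. -/
def eulerGrid (T : ℝ≥0) (N : ℕ) (μ : ℝ≥0 → EuclideanSpace ℝ ι → EuclideanSpace ℝ ι)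
    (σ : ℝ≥0 → EuclideanSpace ℝ ι → Matrix ι κ ℝ) (W : ℝ≥0 → Ω → EuclideanSpace ℝ κ)
    (x : EuclideanSpace ℝ ι) (ω : Ω) : ℕ → EuclideanSpace ℝ ι
  | 0 => x
  | n + 1 =>
    let e := eulerGrid T N μ σ W x ω n
    let t := gridTime T N n
    let t' := gridTime T N (n + 1)
    e + ((t' : ℝ) - t) • μ t e + WithLp.toLp 2 (σ t e *ᵥ (W t' ω - W t ω).ofLp)

/-- The Euler scheme `E(x)_t = x + ∫₀ᵗ μ(⌊s⌋, E(x)_⌊s⌋) ds + ∫₀ᵗ σ(⌊s⌋, E(x)_⌊s⌋) dW_s` on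
`[0, T]`, where `⌊s⌋` is the last grid point before `s`. The integrands are step processes with
the values `μ(t_n, E_{t_n})` and `σ(t_n, E_{t_n})` on the intervals `[t_n, t_{n+1})`, so that the
two integrals are the sums below. -/
def eulerScheme (T : ℝ≥0) (N : ℕ) (μ : ℝ≥0 → EuclideanSpace ℝ ι → EuclideanSpace ℝ ι)
    (σ : ℝ≥0 → EuclideanSpace ℝ ι → Matrix ι κ ℝ) (W : ℝ≥0 → Ω → EuclideanSpace ℝ κ)
    (x : EuclideanSpace ℝ ι) (t : Set.Icc 0 T) (ω : Ω) : EuclideanSpace ℝ ι :=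
  x + ∑ n ∈ Finset.range N,
        (((min (t : ℝ≥0) (gridTime T N (n + 1)) : ℝ≥0) : ℝ)
          - (min (t : ℝ≥0) (gridTime T N n) : ℝ≥0)) •
            μ (gridTime T N n) (eulerGrid T N μ σ W x ω n)
    + ∑ n ∈ Finset.range N,
        WithLp.toLp 2 (σ (gridTime T N n) (eulerGrid T N μ σ W x ω n) *ᵥ
          (W (min t (gridTime T N (n + 1))) ω - W (min t (gridTime T N n)) ω).ofLp)

end Stochastic

end

/-! For a fixed outcome, the Euler scheme is a deterministic functional of the driving path `y = (t,
W t)`: finitely many sums and compositions of the coefficients with increments of `y`. The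
functional is continuous in `y`, differentiable in the initial value `x` as a map into continuous
paths, and both its norm and its Lipschitz constant in `x` are bounded by polynomials in the
supremum norm of `y` (`exists_norm_drivenPath_le`, `exists_norm_drivenPath_sub_le`). The supremum of
`W` over `[0, T]` has moments of all orders, by chaining over dyadic grids
(`IsWienerProcess.memLp_pathOf`). Hence the scheme has all moments, and so does its random Lipschitz
constant.

Differentiability in `L^p` then follows by dominated convergence: the normalised remainders tend to
zero pathwise and are dominated by twice the Lipschitz constant
(`Lp.tendsto_remainder_of_ae_hasFDerivAt`). The derivative in `L^p` is therefore the class of the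
pathwise derivative.

The pathwise derivative is identified through the chain rule, which says that the augmented
derivative respects composition (`augDeriv_comp`). It also respects sums and continuous linear maps,
so applying it to the Euler recursion gives the same recursion with augmented coefficients
(`sumEquivProd_eulerGrid`, `sumEquivProd_eulerScheme`). These coefficients are again continuous and
of linear growth, which suffices for the moments of the augmented scheme. -/

open Filter Topology

/-! ### Random continuous functions and differentiation in `L^p` -/

/-- A random continuous function on a compact space is measurable if all its values are. -/
theorem ContinuousMap.stronglyMeasurable_of_apply {Ω K V : Type*} [MeasurableSpace Ω]
    [TopologicalSpace K] [CompactSpace K] [SecondCountableTopology K] [LocallyCompactSpace K]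
    [NormedAddCommGroup V] [SecondCountableTopology V] [MeasurableSpace V] [BorelSpace V]
    {X : Ω → C(K, V)} (hX : ∀ t, Measurable fun ω => X ω t) : StronglyMeasurable X := by
  borelize C(K, V)
  refine Measurable.stronglyMeasurable ?_
  have hball (f : C(K, V)) (r : ℝ) : MeasurableSet (X ⁻¹' Metric.closedBall f r) := by
    rcases lt_or_ge r 0 with hr | hr
    · simp [Metric.closedBall_eq_empty.2 hr]
    -- By continuity the supremum distance is determined on a countable dense set, so the preimage
    -- of a closed ball is a countable intersection.
    · have hS : X ⁻¹' Metric.closedBall f r =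
          {ω | ∀ t ∈ TopologicalSpace.exists_countable_dense K |>.choose,
            dist (X ω t) (f t) ≤ r} := by
        ext ω
        rw [Set.mem_preimage, Metric.mem_closedBall, ContinuousMap.dist_le hr]
        refine ⟨fun h t _ => h t, fun h t => ?_⟩
        have hcl : IsClosed {t | dist (X ω t) (f t) ≤ r} :=
          isClosed_le (by fun_prop) continuous_const
        exact hcl.closure_subset_iff.2 h
          ((TopologicalSpace.exists_countable_dense K).choose_spec.2 t)
      rw [hS, Set.ofPred_forall]
      simp_rw [Set.ofPred_forall]
      refine MeasurableSet.biInter (TopologicalSpace.exists_countable_dense K).choose_spec.1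
        fun t _ => ?_
      exact measurableSet_le ((hX t).dist measurable_const) measurable_const
  refine measurable_of_isOpen fun U hU => ?_
  -- Second countability of `C(K, V)` writes an open set as a countable union of closed balls
  -- contained in it.
  choose! r hr hrU using fun f (hf : f ∈ U) => Metric.nhds_basis_closedBall.mem_iff.1 (hU.mem_nhds hf)
  obtain ⟨A, hAU, hA, hcov⟩ := TopologicalSpace.countable_cover_nhdsWithin (s := U)
    (f := fun f => Metric.closedBall f (r f))
    fun f hf => mem_nhdsWithin_of_mem_nhds (Metric.closedBall_mem_nhds f (hr f hf))
  have hU' : X ⁻¹' U = ⋃ f ∈ A, X ⁻¹' Metric.closedBall f (r f) := by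
    ext ω
    simp only [Set.mem_preimage, Set.mem_iUnion, exists_prop]
    constructor
    · intro h
      simpa using hcov h
    · rintro ⟨f, hf, h⟩
      exact hrU f (hAU hf) h
  rw [hU']
  exact MeasurableSet.biUnion hA fun f _ => hball f _

/-- If `x ↦ f x ω` is almost surely differentiable at `x₀` with an `L^p` Lipschitz constant, then
`f` is differentiable at `x₀` as a map into `L^p`, in the sense that the remainder is small. -/
theorem MeasureTheory.Lp.tendsto_remainder_of_ae_hasFDerivAt {Ω B E : Type*} [MeasurableSpace Ω]
    {P : Measure Ω} [NormedAddCommGroup B] [NormedSpace ℝ B] [NormedAddCommGroup E]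
    [NormedSpace ℝ E] {p : ℝ≥0∞} [Fact (1 ≤ p)] (hp : p ≠ ∞) {F Y : B → Lp E p P} {x₀ : B}
    {f : B → Ω → E} {D : Ω → B →L[ℝ] E} {L : Ω → ℝ} (hL : MemLp L p P)
    (hF : ∀ x, F x =ᵐ[P] f x) (hY : ∀ h, Y h =ᵐ[P] fun ω => D ω h)
    (hD : ∀ᵐ ω ∂P, HasFDerivAt (fun x => f x ω) (D ω) x₀)
    (hlip : ∀ᵐ ω ∂P, 0 ≤ L ω ∧ ∀ x, ‖f x ω - f x₀ ω‖ ≤ L ω * ‖x - x₀‖) :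
    Tendsto (fun x => ‖x - x₀‖⁻¹ * ‖F x - F x₀ - Y (x - x₀)‖) (𝓝 x₀) (𝓝 0) := by
  have hp0 : p ≠ 0 := (zero_lt_one.trans_le Fact.out).ne'
  have hpos : 0 < p.toReal := ENNReal.toReal_pos hp0 hp
  have key : ∀ x, ((‖x - x₀‖⁻¹ • (F x - F x₀ - Y (x - x₀)) : Lp E p P) : Ω → E) =ᵐ[P]
      fun ω => ‖x - x₀‖⁻¹ • (f x ω - f x₀ ω - D ω (x - x₀)) := fun x => by
    filter_upwards [Lp.coeFn_smul ‖x - x₀‖⁻¹ (F x - F x₀ - Y (x - x₀)),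
      Lp.coeFn_sub (F x - F x₀) (Y (x - x₀)), Lp.coeFn_sub (F x) (F x₀), hF x, hF x₀,
      hY (x - x₀)] with ω h1 h2 h3 h4 h5 h6
    rw [h1, Pi.smul_apply, h2, Pi.sub_apply, h3, Pi.sub_apply, h4, h5, h6]
  have hnorm : ∀ x, ‖x - x₀‖⁻¹ * ‖F x - F x₀ - Y (x - x₀)‖ =
      ((∫⁻ ω, ‖(‖x - x₀‖⁻¹ • (F x - F x₀ - Y (x - x₀)) : Lp E p P) ω‖ₑ ^ p.toReal ∂P) ^
        (1 / p.toReal)).toReal := fun x => by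
    rw [← eLpNorm_eq_lintegral_rpow_enorm_toReal hp0 hp, ← Lp.norm_def, norm_smul]
    simp
  -- The almost sure identities `key x` have a null set depending on `x`; along a sequence these
  -- null sets can be united.
  refine tendsto_of_seq_tendsto fun u hu => ?_
  simp_rw [hnorm]
  have hlim : Tendsto (fun k => ∫⁻ ω, ‖(‖u k - x₀‖⁻¹ • (F (u k) - F x₀ - Y (u k - x₀)) :
      Lp E p P) ω‖ₑ ^ p.toReal ∂P) atTop (𝓝 (∫⁻ _, 0 ∂P)) := by
    refine tendsto_lintegral_filter_of_dominated_convergence'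
      -- One `L` bounds the difference quotient, the other bounds `‖D ω‖`, since a derivative is at
      -- most the Lipschitz constant.
      (fun ω => ‖(2 * L ω)‖ₑ ^ p.toReal) ?_ ?_ ?_ ?_
    · exact .of_forall fun k => (Lp.aestronglyMeasurable _).enorm.pow_const _
    · refine .of_forall fun k => ?_
      obtain ⟨x, hxk⟩ : ∃ x, u k = x := ⟨_, rfl⟩
      rw [hxk]
      filter_upwards [key x, hD, hlip] with ω h1 h2 h3
      refine ENNReal.rpow_le_rpow ?_ hpos.le
      rw [h1]
      refine enorm_le_iff_norm_le.2 ?_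
      rcases eq_or_ne x x₀ with rfl | hx
      · simp
      have hx' : 0 < ‖x - x₀‖ := norm_pos_iff.2 (sub_ne_zero.2 hx)
      have hDL : ‖D ω‖ ≤ L ω := h2.le_of_lip' h3.1 (.of_forall h3.2)
      have h4 : ‖f x ω - f x₀ ω - D ω (x - x₀)‖ ≤ 2 * L ω * ‖x - x₀‖ := by
        have := (norm_sub_le (f x ω - f x₀ ω) (D ω (x - x₀))).trans
          (add_le_add (h3.2 x) ((D ω).le_of_opNorm_le hDL (x - x₀)))
        linarith
      rw [norm_smul, norm_inv, norm_norm, inv_mul_le_iff₀ hx', Real.norm_of_nonneg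
        (by linarith [h3.1]), mul_comm]
      exact h4
    · have h := (hL.const_mul 2).eLpNorm_ne_top
      rw [eLpNorm_eq_lintegral_rpow_enorm_toReal hp0 hp] at h
      intro htop
      rw [htop, ENNReal.top_rpow_of_pos (by positivity)] at h
      exact h rfl
    · have hall : ∀ᵐ ω ∂P, ∀ k, ((‖u k - x₀‖⁻¹ • (F (u k) - F x₀ - Y (u k - x₀)) : Lp E p P) :
          Ω → E) ω = ‖u k - x₀‖⁻¹ • (f (u k) ω - f x₀ ω - D ω (u k - x₀)) :=
        ae_all_iff.2 fun k => key (u k)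
      filter_upwards [hall, hD] with ω h1 h2
      have h3 : Tendsto (fun k => ‖u k - x₀‖⁻¹ • (f (u k) ω - f x₀ ω - D ω (u k - x₀)))
          atTop (𝓝 0) := by
        rw [tendsto_zero_iff_norm_tendsto_zero]
        simpa [norm_smul, Function.comp_def] using (hasFDerivAt_iff_tendsto.1 h2).comp hu
      have h4 : Tendsto (fun e : E => ‖e‖ₑ ^ p.toReal) (𝓝 0) (𝓝 0) := by
        have := (ENNReal.continuous_rpow_const (y := p.toReal)).comp (continuous_enorm (E := E))
          |>.tendsto 0
        simpa [Function.comp_def, ENNReal.zero_rpow_of_pos hpos] using this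
      simpa only [h1, Function.comp_def] using h4.comp h3
  have h0 : Tendsto (fun y : ℝ≥0∞ => (y ^ (1 / p.toReal)).toReal) (𝓝 0) (𝓝 0) := by
    have h1 : Tendsto (fun y : ℝ≥0∞ => y ^ (1 / p.toReal)) (𝓝 0) (𝓝 0) := by
      have := (ENNReal.continuous_rpow_const (y := 1 / p.toReal)).tendsto 0
      rwa [ENNReal.zero_rpow_of_pos (by positivity)] at this
    simpa [Function.comp_def] using (ENNReal.tendsto_toReal ENNReal.zero_ne_top).comp h1
  rw [lintegral_zero] at hlim
  exact h0.comp hlim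

/-! ### Grid points and dyadic chaining -/

theorem gridTime_zero_right (T : ℝ≥0) (N : ℕ) : gridTime T N 0 = 0 := by simp [gridTime]

theorem gridTime_mono (T : ℝ≥0) (N : ℕ) : Monotone (gridTime T N) := fun m n h => by
  unfold gridTime; gcongr

theorem gridTime_le {T : ℝ≥0} {N n : ℕ} (h : n ≤ N) : gridTime T N n ≤ T := by
  unfold gridTime
  refine NNReal.div_le_of_le_mul ?_
  rw [mul_comm]
  gcongr

/-- The increments of `g` over the dyadic grids of `[0, T]` bound `g`. -/
theorem norm_le_of_dyadic_increments {E : Type*} [NormedAddCommGroup E] {g : ℝ≥0 → E}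
    (hg : Continuous g) (hg0 : g 0 = 0) {T : ℝ≥0} (hT : 0 < T) {K ρ : ℝ} (hK : 0 ≤ K)
    (hρ : 0 ≤ ρ) (hρ1 : ρ < 1)
    (h : ∀ l, ∀ i < 2 ^ l,
      ‖g (gridTime T (2 ^ l) (i + 1)) - g (gridTime T (2 ^ l) i)‖ ≤ K * ρ ^ l)
    {t : ℝ≥0} (ht : t ≤ T) : ‖g t‖ ≤ K * (1 - ρ)⁻¹ := by
  have hdy : ∀ l, ∀ j ≤ 2 ^ l,
      ‖g (gridTime T (2 ^ l) j)‖ ≤ ∑ k ∈ Finset.range (l + 1), K * ρ ^ k := by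
    intro l
    induction l with
    | zero =>
      intro j hj
      have h0 := h 0 0 (by simp)
      simp only [gridTime_zero_right, hg0, sub_zero] at h0
      obtain rfl | rfl : j = 0 ∨ j = 1 := by simp at hj; omega
      · simpa [gridTime_zero_right, hg0] using hK
      · simpa using h0
    | succ l ih =>
      have heven : ∀ i, gridTime T (2 ^ (l + 1)) (2 * i) = gridTime T (2 ^ l) i := fun i => by
        simp only [gridTime, pow_succ]
        push_cast
        field_simp
      intro j hj
      rw [Finset.sum_range_succ]
      obtain ⟨i, rfl | rfl⟩ := Nat.even_or_odd' j
      · rw [heven]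
        exact (ih i (by rw [pow_succ] at hj; omega)).trans (le_add_of_nonneg_right (by positivity))
      -- An odd point is one increment of level `l + 1` away from its left neighbour, which lies on
      -- the coarser grid.
      · have h1 := h (l + 1) (2 * i) (by omega)
        rw [heven] at h1
        have h2 := ih i (by rw [pow_succ] at hj; omega)
        calc _ ≤ _ := norm_le_norm_add_norm_sub' _ (g (gridTime T (2 ^ l) i))
          _ ≤ _ := by gcongr
  have hsum : ∀ l, ∑ k ∈ Finset.range (l + 1), K * ρ ^ k ≤ K * (1 - ρ)⁻¹ := fun l => by
    rw [← Finset.mul_sum, ← tsum_geometric_of_lt_one hρ hρ1]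
    gcongr
    exact (summable_geometric_of_lt_one hρ hρ1).sum_le_tsum _ fun i _ => by positivity
  have hT' : (0 : ℝ) < T := hT
  have htT : (t : ℝ) / T ≤ 1 := div_le_one_of_le₀ (by exact_mod_cast ht) hT'.le
  -- Rounding `t` down to the dyadic grids approximates it, so continuity carries the bound from
  -- dyadic points to `t`.
  have hlim : Tendsto (fun l : ℕ => gridTime T (2 ^ l) ⌊(t / T : ℝ) * 2 ^ l⌋₊) atTop (𝓝 t) := by
    rw [← NNReal.tendsto_coe]
    have h1 : Tendsto (fun l : ℕ => (⌊(t / T : ℝ) * 2 ^ l⌋₊ : ℝ) / 2 ^ l) atTop (𝓝 (t / T)) :=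
      (tendsto_nat_floor_mul_div_atTop (R := ℝ) (a := t / T) (by positivity)).comp
        (tendsto_pow_atTop_atTop_of_one_lt one_lt_two)
    have h2 := h1.mul_const (T : ℝ)
    rw [div_mul_cancel₀ _ hT'.ne'] at h2
    refine h2.congr fun l => ?_
    simp only [gridTime]
    push_cast
    ring
  refine le_of_tendsto ((hg.norm.tendsto t).comp hlim) (.of_forall fun l => ?_)
  refine (hdy l _ ?_).trans (hsum l)
  refine Nat.floor_le_of_le ?_
  push_cast
  exact mul_le_of_le_one_left (by positivity) htT

theorem pathOf_apply {Ω V : Type*} [NormedAddCommGroup V] {T : ℝ≥0}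
    {X : Set.Icc 0 T → Ω → V} {ω : Ω} (h : Continuous fun t => X t ω) (t : Set.Icc 0 T) :
    pathOf X ω t = X t ω := by
  simp [pathOf, h]

/-! ### Moments of the supremum of a Wiener process -/

section Wiener

variable {Ω κ : Type*} {mΩ : MeasurableSpace Ω} [Fintype κ] {P : Measure Ω}
  {ℱ : Filtration ℝ≥0 mΩ} {W : ℝ≥0 → Ω → EuclideanSpace ℝ κ}

theorem IsWienerProcess.measurable (hW : IsWienerProcess P ℱ W) (t : ℝ≥0) : Measurable (W t) :=
  (hW.adapted t).mono (ℱ.le t) le_rfl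

theorem IsWienerProcess.lintegral_increment_pow (hW : IsWienerProcess P ℱ W) {s t : ℝ≥0}
    (h : s ≤ t) (q : ℕ) : ∫⁻ ω, ‖W t ω - W s ω‖ₑ ^ q ∂P =
      ENNReal.ofReal √((t : ℝ) - s) ^ q * ∫⁻ x, ‖x‖ₑ ^ q ∂stdGaussian (EuclideanSpace ℝ κ) := by
  have h1 : ∫⁻ ω, ‖W t ω - W s ω‖ₑ ^ q ∂P =
      ∫⁻ x, ‖x‖ₑ ^ q ∂P.map (fun ω => W t ω - W s ω) := by
    exact (lintegral_map (f := fun x : EuclideanSpace ℝ κ => ‖x‖ₑ ^ q) (by fun_prop)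
      ((hW.measurable t).sub (hW.measurable s))).symm
  rw [h1, hW.law_increment s t h, lintegral_map (by fun_prop) (by fun_prop),
    ← lintegral_const_mul _ (by fun_prop)]
  refine lintegral_congr fun x => ?_
  rw [enorm_smul, mul_pow, Real.enorm_of_nonneg (Real.sqrt_nonneg _)]

theorem lintegral_enorm_pow_stdGaussian_ne_top {q : ℕ} (hq : q ≠ 0) :
    ∫⁻ x, ‖x‖ₑ ^ q ∂stdGaussian (EuclideanSpace ℝ κ) ≠ ∞ := by
  have h := (IsGaussian.memLp_id (stdGaussian (EuclideanSpace ℝ κ)) q (by simp)).eLpNorm_ne_top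
  rw [eLpNorm_eq_lintegral_rpow_enorm_toReal (by simpa using hq) (by simp)] at h
  intro htop
  refine h ?_
  simp [htop, Nat.pos_of_ne_zero hq]

/-- The weighted sum of the `8 m`-th powers of the increments over the dyadic grids of `[0, T]`. -/
noncomputable def dyadicSum (W : ℝ≥0 → Ω → EuclideanSpace ℝ κ) (T : ℝ≥0) (m : ℕ) (ω : Ω) : ℝ≥0∞ :=
  ∑' l : ℕ, ∑ i ∈ Finset.range (2 ^ l), 4 ^ (m * l) *
    ‖W (gridTime T (2 ^ l) (i + 1)) ω - W (gridTime T (2 ^ l) i) ω‖ₑ ^ (8 * m)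

/-- By Gaussian scaling an increment of level `l` has `8 m`-th moment `C T ^ (4 m) 16 ^ (-m l)`. The
weight `4 ^ (m l)` leaves `4 ^ (-m l)`, and the `2 ^ l` increments of the level contribute a
multiple of at most `2 ^ (-l)` because `m ≥ 1`. The series is thus geometric. -/
theorem IsWienerProcess.lintegral_dyadicSum_ne_top (hW : IsWienerProcess P ℱ W) (T : ℝ≥0)
    {m : ℕ} (hm : m ≠ 0) : ∫⁻ ω, dyadicSum W T m ω ∂P ≠ ∞ := by
  have hmeas := hW.measurable
  have hC := lintegral_enorm_pow_stdGaussian_ne_top (κ := κ) (q := 8 * m) (by omega)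
  set C := ∫⁻ x, ‖x‖ₑ ^ (8 * m) ∂stdGaussian (EuclideanSpace ℝ κ)
  have hterm : ∀ l i, ∫⁻ ω, 4 ^ (m * l) *
      ‖W (gridTime T (2 ^ l) (i + 1)) ω - W (gridTime T (2 ^ l) i) ω‖ₑ ^ (8 * m) ∂P =
      ENNReal.ofReal (T ^ (4 * m) * (1 / 4) ^ (m * l)) * C := fun l i => by
    rw [lintegral_const_mul _ (by fun_prop),
      hW.lintegral_increment_pow (gridTime_mono T _ (Nat.le_succ i)), ← mul_assoc]
    congr 1
    have h1 : ((gridTime T (2 ^ l) (i + 1) : ℝ≥0) : ℝ) - gridTime T (2 ^ l) i = T / 2 ^ l := by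
      simp only [gridTime]
      push_cast
      ring
    have h2 : (4 : ℝ≥0∞) ^ (m * l) = ENNReal.ofReal (4 ^ (m * l)) := by
      rw [ENNReal.ofReal_pow (by norm_num)]; norm_num
    rw [h1, ← ENNReal.ofReal_pow (by positivity), h2, ← ENNReal.ofReal_mul (by positivity)]
    congr 1
    have h3 : √((T : ℝ) / 2 ^ l) ^ (8 * m) = (T / 2 ^ l) ^ (4 * m) := by
      rw [show 8 * m = 2 * (4 * m) by ring, pow_mul, Real.sq_sqrt (by positivity)]
    rw [h3, div_pow, ← pow_mul, show l * (4 * m) = 4 * (m * l) by ring, pow_mul 2 4, one_div,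
      inv_pow, show ((2 : ℝ) ^ 4) = 4 * 4 by norm_num, mul_pow]
    field_simp
  unfold dyadicSum
  rw [lintegral_tsum fun l => by fun_prop]
  have hle : ∀ l, ∫⁻ ω, ∑ i ∈ Finset.range (2 ^ l), 4 ^ (m * l) *
      ‖W (gridTime T (2 ^ l) (i + 1)) ω - W (gridTime T (2 ^ l) i) ω‖ₑ ^ (8 * m) ∂P ≤
      ENNReal.ofReal (T ^ (4 * m) * (1 / 2) ^ l) * C := fun l => by
    rw [lintegral_finsetSum _ fun i _ => by fun_prop]
    simp_rw [hterm]
    rw [Finset.sum_const, Finset.card_range, nsmul_eq_mul, ← mul_assoc]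
    gcongr
    rw [← ENNReal.ofReal_natCast, ← ENNReal.ofReal_mul (by positivity)]
    refine ENNReal.ofReal_le_ofReal ?_
    push_cast
    have h1 : ((1 : ℝ) / 4) ^ (m * l) ≤ (1 / 4) ^ l :=
      pow_le_pow_of_le_one (by norm_num) (by norm_num)
        (Nat.le_mul_of_pos_left l (Nat.pos_of_ne_zero hm))
    calc (2 : ℝ) ^ l * (T ^ (4 * m) * (1 / 4) ^ (m * l))
        ≤ 2 ^ l * (T ^ (4 * m) * (1 / 4) ^ l) := by gcongr
      _ = T ^ (4 * m) * (2 * (1 / 4)) ^ l := by rw [mul_pow]; ring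
      _ = _ := by norm_num
  refine ne_top_of_le_ne_top ?_ (ENNReal.tsum_le_tsum hle)
  rw [ENNReal.tsum_mul_right]
  refine ENNReal.mul_ne_top ?_ hC
  rw [← ENNReal.ofReal_tsum_of_nonneg (fun l => by positivity)
    ((summable_geometric_of_lt_one (by norm_num) (by norm_num)).mul_left _)]
  exact ENNReal.ofReal_ne_top

/-- The supremum of a Wiener process over `[0, T]` has moments of all orders. -/
theorem IsWienerProcess.memLp_pathOf (hW : IsWienerProcess P ℱ W) [IsProbabilityMeasure P]
    (hℱ : UsualConditions P ℱ) {T : ℝ≥0} (hT : 0 < T) {p : ℝ≥0∞} (hp : p ≠ ∞) :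
    MemLp (pathOf fun (t : Set.Icc 0 T) => W t) p P := by
  have hmeas := hW.measurable
  -- The complement is a null set, and the usual conditions make null sets measurable.
  have hA : MeasurableSet {ω | Continuous fun t : Set.Icc 0 T => W t ω} := by
    refine MeasurableSet.of_compl (ℱ.le 0 _ (hℱ.null_sets _ ?_))
    refine measure_mono_null ?_ (ae_iff.1 hW.continuous_paths)
    exact fun ω hω hc => hω (hc.comp continuous_subtype_val)
  have hsm : AEStronglyMeasurable (pathOf fun (t : Set.Icc 0 T) => W t) P := by
    refine (ContinuousMap.stronglyMeasurable_of_apply fun t => ?_).aestronglyMeasurable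
    have : (fun ω => pathOf (fun (t : Set.Icc 0 T) => W t) ω t) =
        {ω | Continuous fun t : Set.Icc 0 T => W t ω}.indicator (W t) := by
      ext1 ω
      by_cases h : Continuous fun t : Set.Icc 0 T => W t ω <;> simp [pathOf, h]
    rw [this]
    exact (hmeas t).indicator hA
  obtain ⟨m, hm⟩ := ENNReal.exists_nat_gt hp
  have hm0 : m ≠ 0 := by rintro rfl; simp at hm
  have h8 : 8 * m ≠ 0 := by omega
  suffices h : MemLp (pathOf fun (t : Set.Icc 0 T) => W t) ((8 * m : ℕ) : ℝ≥0∞) P from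
    h.mono_exponent (hm.le.trans (by exact_mod_cast (by omega : m ≤ 8 * m)))
  refine ⟨hsm, ?_⟩
  rw [eLpNorm_lt_top_iff_lintegral_rpow_enorm_lt_top (by exact_mod_cast h8)
    (ENNReal.natCast_ne_top _)]
  simp only [ENNReal.toReal_natCast, ENNReal.rpow_natCast]
  have hfin := hW.lintegral_dyadicSum_ne_top T hm0
  have hDm : Measurable (dyadicSum W T m) := by
    unfold dyadicSum
    exact Measurable.tsum fun l => by fun_prop
  -- The `8 m`-th root of `4 ^ (-m l)`, the inverse of the weight in `dyadicSum`, is `ρ ^ l`.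
  set ρ : ℝ := (1 / 4) ^ (((8 : ℕ) : ℝ)⁻¹)
  have hρ0 : 0 ≤ ρ := by positivity
  have hρ8 : ρ ^ 8 = 1 / 4 := Real.rpow_inv_natCast_pow (by norm_num) (by norm_num)
  have hρ1 : ρ < 1 := Real.rpow_lt_one (by norm_num) (by norm_num) (by norm_num)
  have hbound : ∀ᵐ ω ∂P, ‖pathOf (fun (t : Set.Icc 0 T) => W t) ω‖ₑ ^ (8 * m) ≤
      ENNReal.ofReal ((1 - ρ)⁻¹ ^ (8 * m)) * dyadicSum W T m ω := by
    filter_upwards [hW.continuous_paths, hW.zero, ae_lt_top hDm hfin] with ω hc h0 hlt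
    set K : ℝ := (dyadicSum W T m ω).toReal ^ (((8 * m : ℕ) : ℝ)⁻¹)
    have hK0 : 0 ≤ K := by positivity
    have hK : K ^ (8 * m) = (dyadicSum W T m ω).toReal :=
      Real.rpow_inv_natCast_pow ENNReal.toReal_nonneg h8
    -- After taking `8 m`-th powers, this says that a single term is at most the whole `dyadicSum`.
    have hinc : ∀ l, ∀ i < 2 ^ l, ‖W (gridTime T (2 ^ l) (i + 1)) ω -
        W (gridTime T (2 ^ l) i) ω‖ ≤ K * ρ ^ l := fun l i hi => by
      rw [← pow_le_pow_iff_left₀ (norm_nonneg _) (by positivity) h8, mul_pow, hK, ← pow_mul,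
        show l * (8 * m) = 8 * (m * l) by ring, pow_mul ρ, hρ8, one_div, inv_pow,
        ← div_eq_mul_inv, le_div_iff₀ (by positivity), mul_comm]
      have h1 : 4 ^ (m * l) * ‖W (gridTime T (2 ^ l) (i + 1)) ω -
          W (gridTime T (2 ^ l) i) ω‖ₑ ^ (8 * m) ≤ dyadicSum W T m ω :=
        (Finset.single_le_sum (f := fun i => 4 ^ (m * l) * ‖W (gridTime T (2 ^ l) (i + 1)) ω -
          W (gridTime T (2 ^ l) i) ω‖ₑ ^ (8 * m)) (fun _ _ => zero_le)
          (Finset.mem_range.2 hi)).trans (ENNReal.le_tsum l)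
      have h2 := ENNReal.toReal_mono hlt.ne h1
      simpa using h2
    have hle : ‖pathOf (fun (t : Set.Icc 0 T) => W t) ω‖ ≤ K * (1 - ρ)⁻¹ := by
      refine (ContinuousMap.norm_le _ (mul_nonneg hK0 (by
        have := sub_pos.2 hρ1; positivity))).2 fun t => ?_
      rw [pathOf_apply (hc.comp continuous_subtype_val)]
      exact norm_le_of_dyadic_increments hc h0 hT hK0 hρ0 hρ1 hinc t.2.2
    rw [← ofReal_norm, ← ENNReal.ofReal_pow (norm_nonneg _), ← ENNReal.ofReal_toReal hlt.ne, ← hK,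
      ← ENNReal.ofReal_mul (by have := sub_pos.2 hρ1; positivity), ← mul_pow, mul_comm _ K]
    exact ENNReal.ofReal_le_ofReal (pow_le_pow_left₀ (norm_nonneg _) hle _)
  refine (lintegral_mono_ae hbound).trans_lt ?_
  rw [lintegral_const_mul _ hDm]
  exact ENNReal.mul_lt_top ENNReal.ofReal_lt_top hfin.lt_top

end Wiener

/-! ### Euler schemes driven by a deterministic path -/

section Driven

variable {K G V : Type*} [TopologicalSpace K] [CompactSpace K] [NormedAddCommGroup G]
  [NormedSpace ℝ G] [NormedAddCommGroup V] [NormedSpace ℝ V]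

/-- Composition `(A, y) ↦ A ∘ y` of continuous linear maps with continuous functions. -/
noncomputable def compLeftCLM (K G V : Type*) [TopologicalSpace K] [CompactSpace K]
    [NormedAddCommGroup G] [NormedSpace ℝ G] [NormedAddCommGroup V] [NormedSpace ℝ V] :
    (G →L[ℝ] V) →L[ℝ] C(K, G) →L[ℝ] C(K, V) :=
  LinearMap.mkContinuous₂
    (LinearMap.mk₂ ℝ (fun (A : G →L[ℝ] V) (y : C(K, G)) => ⟨fun t => A (y t), by fun_prop⟩)
      (fun A B y => by ext; simp) (fun c A y => by ext; simp) (fun A y z => by ext; simp)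
      (fun c A y => by ext; simp)) 1
    (fun A y => by
      refine (ContinuousMap.norm_le _ (by positivity)).2 fun t => ?_
      simpa using A.le_of_opNorm_le_of_le le_rfl (y.norm_coe_le_norm t))

@[simp]
theorem compLeftCLM_apply (A : G →L[ℝ] V) (y : C(K, G)) (t : K) :
    compLeftCLM K G V A y t = A (y t) := rfl

theorem norm_compLeftCLM_le (A : G →L[ℝ] V) (y : C(K, G)) :
    ‖compLeftCLM K G V A y‖ ≤ ‖A‖ * ‖y‖ :=
  (ContinuousMap.norm_le _ (by positivity)).2 fun t =>
    A.le_of_opNorm_le_of_le le_rfl (y.norm_coe_le_norm t)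

/-- The values at the points `τ n` of the Euler scheme for the differential equation
`dX = F(X) dy` driven by the path `y`. -/
def drivenGrid (τ : ℕ → K) (F : ℕ → V → G →L[ℝ] V) (y : C(K, G)) (x : V) : ℕ → V
  | 0 => x
  | n + 1 => drivenGrid τ F y x n + F n (drivenGrid τ F y x n) (y (τ (n + 1)) - y (τ n))

/-- The Euler scheme for the differential equation `dX = F(X) dy` driven by the path `y`, where
`c n` stops the time at the `n`-th grid point. -/
noncomputable def drivenPath (τ : ℕ → K) (c : ℕ → C(K, K)) (N : ℕ) (F : ℕ → V → G →L[ℝ] V)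
    (y : C(K, G)) (x : V) : C(K, V) :=
  ContinuousMap.const K x + ∑ n ∈ Finset.range N,
    compLeftCLM K G V (F n (drivenGrid τ F y x n)) (y.comp (c (n + 1)) - y.comp (c n))

variable {τ : ℕ → K} {c : ℕ → C(K, K)} {N : ℕ} {F : ℕ → V → G →L[ℝ] V}

omit [CompactSpace K] in
theorem continuous_drivenGrid (hF : ∀ n < N, Continuous (F n)) (x : V) {n : ℕ} (hn : n ≤ N) :
    Continuous fun y => drivenGrid τ F y x n := by
  induction n with
  | zero => exact continuous_const
  | succ n ih =>
    have h := ih (by omega)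
    have h' := (hF n (by omega)).comp h
    exact h.add (h'.clm_apply (by fun_prop))

/-- Continuity in the driving path yields measurability of the scheme as a random element of the
path space. -/
theorem continuous_drivenPath (hF : ∀ n < N, Continuous (F n)) (x : V) :
    Continuous fun y => drivenPath τ c N F y x := by
  refine continuous_const.add (continuous_finsetSum _ fun n hn => ?_)
  have hn := Finset.mem_range.1 hn
  have h := (hF n hn).comp (continuous_drivenGrid (τ := τ) hF x hn.le)
  refine ((compLeftCLM K G V).continuous.comp h).clm_apply ?_
  exact (ContinuousMap.continuous_precomp _).sub (ContinuousMap.continuous_precomp _)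

omit [CompactSpace K] in
theorem differentiable_drivenGrid (hF : ∀ n < N, Differentiable ℝ (F n)) (y : C(K, G)) {n : ℕ}
    (hn : n ≤ N) : Differentiable ℝ fun x => drivenGrid τ F y x n := by
  induction n with
  | zero => exact differentiable_id
  | succ n ih =>
    have h := ih (by omega)
    have h' := (hF n (by omega)).comp h
    exact h.add (h'.clm_apply (differentiable_const _))

theorem differentiable_drivenPath (hF : ∀ n < N, Differentiable ℝ (F n)) (y : C(K, G)) :
    Differentiable ℝ fun x => drivenPath τ c N F y x := by
  have hconst : Differentiable ℝ fun x : V => ContinuousMap.const K x :=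
    (ContinuousLinearMap.const ℝ K : V →L[ℝ] C(K, V)).differentiable
  refine hconst.add (Differentiable.fun_sum fun n hn => ?_)
  have hn := Finset.mem_range.1 hn
  have h := (hF n hn).comp (differentiable_drivenGrid (τ := τ) hF y hn.le)
  exact ((compLeftCLM K G V).differentiable.comp h).clm_apply (differentiable_const _)

omit [NormedSpace ℝ G] in
theorem norm_sub_apply_le (y : C(K, G)) (s t : K) : ‖y s - y t‖ ≤ 2 * (1 + ‖y‖) := by
  have := norm_sub_le_of_le (y.norm_coe_le_norm s) (y.norm_coe_le_norm t)
  linarith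

omit [NormedSpace ℝ G] in
theorem norm_comp_sub_le (y : C(K, G)) (f g : C(K, K)) :
    ‖y.comp f - y.comp g‖ ≤ 2 * (1 + ‖y‖) :=
  (ContinuousMap.norm_le _ (by positivity)).2 fun t => norm_sub_apply_le y (f t) (g t)

/-- Each step costs at most one more factor `1 + ‖y‖`, because increments of `y` are at most `2 * (1
+ ‖y‖)` and the coefficients grow linearly. -/
theorem exists_norm_drivenGrid_le (hF : ∀ n < N, ∃ C, ∀ v, ‖F n v‖ ≤ C * (1 + ‖v‖)) {n : ℕ}
    (hn : n ≤ N) : ∃ C k, 0 ≤ C ∧ ∀ x y,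
      ‖drivenGrid τ F y x n‖ ≤ C * (1 + ‖x‖) * (1 + ‖y‖) ^ (k : ℕ) := by
  induction n with
  | zero => exact ⟨1, 0, zero_le_one, fun x y => by simp [drivenGrid]⟩
  | succ n ih =>
    obtain ⟨C, k, hC, h⟩ := ih (by omega)
    obtain ⟨C', h'⟩ := hF n (by omega)
    have hC' : 0 ≤ C' := by simpa using (norm_nonneg _).trans (h' 0)
    -- The `1` in `1 + ‖v‖` is absorbed by `(1 + ‖x‖) * (1 + ‖y‖) ^ k ≥ 1`, giving `1 + C`; the `2`
    -- comes from the increment of `y`.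
    refine ⟨C + C' * (1 + C) * 2, k + 1, by positivity, fun x y => ?_⟩
    have h1 := norm_nonneg x
    have h2 := norm_nonneg y
    have h3 : 1 ≤ (1 + ‖x‖) * (1 + ‖y‖) ^ k :=
      one_le_mul_of_one_le_of_one_le (by linarith) (one_le_pow₀ (by linarith))
    have h4 : ‖F n (drivenGrid τ F y x n)‖ ≤ C' * ((1 + C) * ((1 + ‖x‖) * (1 + ‖y‖) ^ k)) := by
      refine (h' _).trans ?_
      gcongr
      linarith [h x y]
    calc ‖drivenGrid τ F y x (n + 1)‖
        ≤ C * (1 + ‖x‖) * (1 + ‖y‖) ^ k * (1 + ‖y‖)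
          + C' * ((1 + C) * ((1 + ‖x‖) * (1 + ‖y‖) ^ k)) * (2 * (1 + ‖y‖)) := by
          refine norm_add_le_of_le ((h x y).trans ?_)
            (ContinuousLinearMap.le_of_opNorm_le_of_le _ h4 (norm_sub_apply_le y _ _))
          exact le_mul_of_one_le_right (by positivity) (by linarith)
      _ = _ := by ring

theorem exists_norm_drivenPath_le (hF : ∀ n < N, ∃ C, ∀ v, ‖F n v‖ ≤ C * (1 + ‖v‖)) (x : V) :
    ∃ C k, ∀ y, ‖drivenPath τ c N F y x‖ ≤ C * (1 + ‖y‖) ^ (k : ℕ) := by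
  have hterm : ∀ M ≤ N, ∃ C k, 0 ≤ C ∧ ∀ y, ‖∑ n ∈ Finset.range M, compLeftCLM K G V
      (F n (drivenGrid τ F y x n)) (y.comp (c (n + 1)) - y.comp (c n))‖ ≤
      C * (1 + ‖y‖) ^ (k : ℕ) := by
    intro M hM
    induction M with
    | zero => exact ⟨0, 0, le_rfl, fun y => by simp⟩
    | succ M ih =>
      obtain ⟨C, k, hC, h⟩ := ih (by omega)
      obtain ⟨C', h'⟩ := hF M (by omega)
      have hC' : 0 ≤ C' := by simpa using (norm_nonneg _).trans (h' 0)
      obtain ⟨D, l, hD, hd⟩ := exists_norm_drivenGrid_le (τ := τ) hF (n := M) (by omega)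
      -- The exponent `k + l + 1` dominates both `k`, from the earlier summands, and `l + 1`, from
      -- the new one.
      refine ⟨C + C' * (1 + D * (1 + ‖x‖)) * 2, k + l + 1, by positivity, fun y => ?_⟩
      have hy : 1 ≤ 1 + ‖y‖ := by linarith [norm_nonneg y]
      have h4 : ‖F M (drivenGrid τ F y x M)‖ ≤
          C' * ((1 + D * (1 + ‖x‖)) * (1 + ‖y‖) ^ l) := by
        refine (h' _).trans ?_
        gcongr
        linarith [hd x y, one_le_pow₀ hy (n := l)]
      rw [Finset.sum_range_succ]
      calc _ ≤ C * (1 + ‖y‖) ^ k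
            + C' * ((1 + D * (1 + ‖x‖)) * (1 + ‖y‖) ^ l) * (2 * (1 + ‖y‖)) := by
            refine norm_add_le_of_le (h y) ((norm_compLeftCLM_le _ _).trans ?_)
            gcongr
            exact norm_comp_sub_le y _ _
        _ ≤ C * (1 + ‖y‖) ^ (k + l + 1)
            + C' * ((1 + D * (1 + ‖x‖)) * 2) * (1 + ‖y‖) ^ (k + l + 1) := by
            refine add_le_add (by gcongr; omega) ?_
            calc _ = C' * ((1 + D * (1 + ‖x‖)) * 2) * (1 + ‖y‖) ^ (l + 1) := by ring
              _ ≤ _ := by gcongr; omega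
        _ = _ := by ring
  obtain ⟨C, k, hC, h⟩ := hterm N le_rfl
  refine ⟨‖x‖ + C, k, fun y => ?_⟩
  have hy : 1 ≤ 1 + ‖y‖ := by linarith [norm_nonneg y]
  rw [add_mul]
  refine norm_add_le_of_le ?_ (h y)
  refine le_trans ((ContinuousMap.norm_le _ (norm_nonneg x)).2 fun t => le_rfl) ?_
  exact le_mul_of_one_le_right (norm_nonneg x) (one_le_pow₀ hy)

/-- The difference of two schemes satisfies a linear recursion whose factor is polynomial in `‖y‖`,
as the coefficients are Lipschitz. -/
theorem exists_norm_drivenGrid_sub_le (hF : ∀ n < N, ∃ C, LipschitzWith C (F n)) {n : ℕ}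
    (hn : n ≤ N) : ∃ C k, 0 ≤ C ∧ ∀ x x' y,
      ‖drivenGrid τ F y x n - drivenGrid τ F y x' n‖ ≤ C * (1 + ‖y‖) ^ (k : ℕ) * ‖x - x'‖ := by
  induction n with
  | zero => exact ⟨1, 0, zero_le_one, fun x x' y => by simp [drivenGrid]⟩
  | succ n ih =>
    obtain ⟨C, k, hC, h⟩ := ih (by omega)
    obtain ⟨C', h'⟩ := hF n (by omega)
    refine ⟨C + C' * C * 2, k + 1, by positivity, fun x x' y => ?_⟩
    have hy : 1 ≤ 1 + ‖y‖ := by linarith [norm_nonneg y]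
    have h4 : ‖F n (drivenGrid τ F y x n) - F n (drivenGrid τ F y x' n)‖ ≤
        C' * (C * (1 + ‖y‖) ^ k * ‖x - x'‖) :=
      (h'.norm_sub_le _ _).trans (by gcongr; exact h x x' y)
    calc ‖drivenGrid τ F y x (n + 1) - drivenGrid τ F y x' (n + 1)‖
        = ‖(drivenGrid τ F y x n - drivenGrid τ F y x' n) +
          (F n (drivenGrid τ F y x n) - F n (drivenGrid τ F y x' n))
            (y (τ (n + 1)) - y (τ n))‖ := by
          simp only [drivenGrid, sub_apply]
          congr 1; abel
      _ ≤ C * (1 + ‖y‖) ^ k * ‖x - x'‖ * (1 + ‖y‖)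
          + C' * (C * (1 + ‖y‖) ^ k * ‖x - x'‖) * (2 * (1 + ‖y‖)) := by
          refine norm_add_le_of_le ((h x x' y).trans ?_)
            (ContinuousLinearMap.le_of_opNorm_le_of_le _ h4 (norm_sub_apply_le y _ _))
          exact le_mul_of_one_le_right (by positivity) hy
      _ = _ := by ring

theorem exists_norm_drivenPath_sub_le (hF : ∀ n < N, ∃ C, LipschitzWith C (F n)) :
    ∃ C k, 0 ≤ C ∧ ∀ x x' y, ‖drivenPath τ c N F y x - drivenPath τ c N F y x'‖ ≤
      C * (1 + ‖y‖) ^ (k : ℕ) * ‖x - x'‖ := by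
  have hterm : ∀ M ≤ N, ∃ C k, 0 ≤ C ∧ ∀ x x' y,
      ‖drivenPath τ c M F y x - drivenPath τ c M F y x'‖ ≤
      C * (1 + ‖y‖) ^ (k : ℕ) * ‖x - x'‖ := by
    intro M hM
    induction M with
    | zero =>
      refine ⟨1, 0, zero_le_one, fun x x' y => ?_⟩
      refine (ContinuousMap.norm_le _ (by positivity)).2 fun t => ?_
      simp [drivenPath]
    | succ M ih =>
      obtain ⟨C, k, hC, h⟩ := ih (by omega)
      obtain ⟨C', h'⟩ := hF M (by omega)
      obtain ⟨D, l, hD, hd⟩ := exists_norm_drivenGrid_sub_le (τ := τ) hF (n := M) (by omega)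
      refine ⟨C + C' * D * 2, k + l + 1, by positivity, fun x x' y => ?_⟩
      have hy : 1 ≤ 1 + ‖y‖ := by linarith [norm_nonneg y]
      have h4 : ‖F M (drivenGrid τ F y x M) - F M (drivenGrid τ F y x' M)‖ ≤
          C' * (D * (1 + ‖y‖) ^ l * ‖x - x'‖) :=
        (h'.norm_sub_le _ _).trans (by gcongr; exact hd x x' y)
      calc _ = ‖(drivenPath τ c M F y x - drivenPath τ c M F y x') + compLeftCLM K G V
            (F M (drivenGrid τ F y x M) - F M (drivenGrid τ F y x' M))
            (y.comp (c (M + 1)) - y.comp (c M))‖ := by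
            simp only [drivenPath, Finset.sum_range_succ, map_sub, sub_apply]
            congr 1; abel
        _ ≤ C * (1 + ‖y‖) ^ k * ‖x - x'‖
            + C' * (D * (1 + ‖y‖) ^ l * ‖x - x'‖) * (2 * (1 + ‖y‖)) := by
            refine norm_add_le_of_le (h x x' y) ((norm_compLeftCLM_le _ _).trans ?_)
            gcongr
            exact norm_comp_sub_le y _ _
        _ ≤ C * (1 + ‖y‖) ^ (k + l + 1) * ‖x - x'‖
            + C' * D * 2 * (1 + ‖y‖) ^ (k + l + 1) * ‖x - x'‖ := by
            refine add_le_add (by gcongr; omega) ?_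
            calc _ = C' * D * 2 * (1 + ‖y‖) ^ (l + 1) * ‖x - x'‖ := by ring
              _ ≤ _ := by gcongr; omega
        _ = _ := by ring
  exact hterm N le_rfl

end Driven

/-! ### Calculus of augmented derivatives -/

section AugDeriv

variable {B₁ B₂ B₃ : Type*} [NormedAddCommGroup B₁] [NormedSpace ℝ B₁]
  [NormedAddCommGroup B₂] [NormedSpace ℝ B₂] [NormedAddCommGroup B₃] [NormedSpace ℝ B₃]

/-- The chain rule in functorial form. Unlike the formula for the derivative alone, it keeps the
base point, so it can be iterated along a recursion. -/
theorem augDeriv_comp {g : B₂ → B₃} {f : B₁ → B₂} (hg : Differentiable ℝ g)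
    (hf : Differentiable ℝ f) (z : B₁ × B₁) :
    augDeriv (fun x => g (f x)) z = augDeriv g (augDeriv f z) := by
  have h : fderiv ℝ (fun x => g (f x)) z.1 = (fderiv ℝ g (f z.1)).comp (fderiv ℝ f z.1) :=
    fderiv_comp z.1 (hg _) (hf _)
  simp [augDeriv, h]

theorem augDeriv_clm_comp (L : B₂ →L[ℝ] B₃) {f : B₁ → B₂} (hf : Differentiable ℝ f)
    (z : B₁ × B₁) : augDeriv (fun x => L (f x)) z = Prod.map L L (augDeriv f z) := by
  have h := augDeriv_comp L.differentiable hf z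
  refine h.trans ?_
  simp [augDeriv]

theorem augDeriv_add {f g : B₁ → B₂} (hf : Differentiable ℝ f) (hg : Differentiable ℝ g)
    (z : B₁ × B₁) : augDeriv (fun x => f x + g x) z = augDeriv f z + augDeriv g z := by
  simp [augDeriv, fderiv_fun_add (hf z.1) (hg z.1)]

theorem augDeriv_sum {ι : Type*} {s : Finset ι} {f : ι → B₁ → B₂}
    (hf : ∀ i ∈ s, Differentiable ℝ (f i)) (z : B₁ × B₁) :
    augDeriv (fun x => ∑ i ∈ s, f i x) z = ∑ i ∈ s, augDeriv (f i) z := by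
  have h := fderiv_fun_sum fun i hi => hf i hi z.1
  simp [augDeriv, h, Prod.ext_iff, Prod.fst_sum, Prod.snd_sum]

theorem augDeriv_id (z : B₁ × B₁) : augDeriv (fun x : B₁ => x) z = z := by
  simp [augDeriv]

theorem continuous_augDeriv {f : B₁ → B₂} (hf : ContDiff ℝ 1 f) : Continuous (augDeriv f) :=
  (hf.continuous.comp continuous_fst).prodMk (hf.continuous_fderiv_apply one_ne_zero)

/-- The first component grows linearly by the mean value inequality, the second by the bound on the
derivative. A Lipschitz bound is not to be expected, since the derivative itself need not be
Lipschitz. -/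
theorem norm_augDeriv_le {f : B₁ → B₂} {C : ℝ} (hf : Differentiable ℝ f)
    (hC : ∀ x, ‖fderiv ℝ f x‖ ≤ C) (z : B₁ × B₁) :
    ‖augDeriv f z‖ ≤ ‖f 0‖ + C * ‖z‖ := by
  have hC0 : 0 ≤ C := (norm_nonneg _).trans (hC 0)
  refine norm_prod_le_iff.2 ⟨?_, ?_⟩
  · have h := convex_univ.norm_image_sub_le_of_norm_fderiv_le (fun x _ => hf x)
      (fun x _ => hC x) (Set.mem_univ 0) (Set.mem_univ z.1)
    rw [sub_zero] at h
    have h2 : C * ‖z.1‖ ≤ C * ‖z‖ := by gcongr; exact norm_fst_le z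
    calc _ ≤ ‖f 0‖ + ‖f z.1 - f 0‖ := norm_le_norm_add_norm_sub' _ _
      _ ≤ _ := by linarith
  · refine (ContinuousLinearMap.le_of_opNorm_le_of_le _ (hC z.1) (norm_snd_le z)).trans ?_
    linarith [norm_nonneg (f 0)]

end AugDeriv

/-! ### The stochastic Euler scheme as a functional of the path `(t, W t)` -/

section Euler

/-- The topology of the Frobenius norm, as a reducible definition. -/
noncomputable abbrev frobeniusTopology (ι κ : Type*) [Fintype ι] [Fintype κ] : TopologicalSpace (Matrix ι κ ℝ) :=
  (Matrix.frobeniusNormedAddCommGroup : NormedAddCommGroup (Matrix ι κ ℝ)).toPseudoMetricSpace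
    |>.toUniformSpace.toTopologicalSpace

attribute [local instance] frobeniusTopology

variable {Ω ι κ : Type*} {mΩ : MeasurableSpace Ω} [Fintype ι] [Fintype κ] {T : ℝ≥0} {N : ℕ}
  {μ : ℝ≥0 → EuclideanSpace ℝ ι → EuclideanSpace ℝ ι}
  {σ : ℝ≥0 → EuclideanSpace ℝ ι → Matrix ι κ ℝ} {W : ℝ≥0 → Ω → EuclideanSpace ℝ κ}

/-- The product of matrices with vectors of Euclidean spaces, as a continuous bilinear map. -/
noncomputable def mulVecCLM (ι κ : Type*) [Fintype ι] [Fintype κ] :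
    Matrix ι κ ℝ →L[ℝ] EuclideanSpace ℝ κ →L[ℝ] EuclideanSpace ℝ ι :=
  LinearMap.toContinuousBilinearMap (LinearMap.mk₂ ℝ
    (fun (A : Matrix ι κ ℝ) (v : EuclideanSpace ℝ κ) => WithLp.toLp 2 (A *ᵥ v.ofLp))
    (fun A B v => by simp [Matrix.add_mulVec]) (fun c A v => by simp [Matrix.smul_mulVec])
    (fun A v w => by simp [Matrix.mulVec_add]) (fun c A v => by simp [Matrix.mulVec_smul]))

/-- The map that sends the values `a`, `A` of a drift and a diffusion coefficient to
`(s, v) ↦ s a + A v`. -/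
noncomputable def coeffCLM (ι κ : Type*) [Fintype ι] [Fintype κ] :
    EuclideanSpace ℝ ι × Matrix ι κ ℝ →L[ℝ]
      ℝ × EuclideanSpace ℝ κ →L[ℝ] EuclideanSpace ℝ ι :=
  LinearMap.toContinuousBilinearMap (LinearMap.mk₂ ℝ
    (fun (a : EuclideanSpace ℝ ι × Matrix ι κ ℝ) (y : ℝ × EuclideanSpace ℝ κ) =>
      y.1 • a.1 + mulVecCLM ι κ a.2 y.2)
    (fun a b y => by simp only [Prod.fst_add, Prod.snd_add, smul_add, map_add, add_apply]; abel)
    (fun c a y => by simp [smul_comm c])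
    (fun a y z => by simp [add_smul]; abel) (fun c a y => by simp [mul_smul]))

theorem coeffCLM_apply (a : EuclideanSpace ℝ ι × Matrix ι κ ℝ) (y : ℝ × EuclideanSpace ℝ κ) :
    coeffCLM ι κ a y = y.1 • a.1 + WithLp.toLp 2 (a.2 *ᵥ y.2.ofLp) := rfl

/-- The drift and the diffusion coefficient at the grid points, as one coefficient for the
driving path `(t, W t)`. -/
noncomputable def eulerCoeff (T : ℝ≥0) (N : ℕ)
    (μ : ℝ≥0 → EuclideanSpace ℝ ι → EuclideanSpace ℝ ι)
    (σ : ℝ≥0 → EuclideanSpace ℝ ι → Matrix ι κ ℝ) (n : ℕ) (x : EuclideanSpace ℝ ι) :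
    ℝ × EuclideanSpace ℝ κ →L[ℝ] EuclideanSpace ℝ ι :=
  coeffCLM ι κ (μ (gridTime T N n) x, σ (gridTime T N n) x)

/-- The grid points as elements of `[0, T]`. -/
noncomputable def gridPoint (T : ℝ≥0) (N n : ℕ) : Set.Icc 0 T :=
  ⟨min T (gridTime T N n), zero_le, min_le_left _ _⟩

/-- The map `t ↦ min t t_n` of `[0, T]`. -/
noncomputable def stopAt (T : ℝ≥0) (N n : ℕ) : C(Set.Icc 0 T, Set.Icc 0 T) :=
  ⟨fun t => ⟨min t (gridTime T N n), zero_le, (min_le_left _ _).trans t.2.2⟩, by fun_prop⟩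

/-- The path `t ↦ (t, 0)`. -/
noncomputable def timePath (T : ℝ≥0) (κ : Type*) [Fintype κ] :
    C(Set.Icc 0 T, ℝ × EuclideanSpace ℝ κ) :=
  ⟨fun t => (((t : ℝ≥0) : ℝ), 0), by fun_prop⟩

/-- The path `t ↦ (t, w t)`. -/
noncomputable def timeSpacePath (w : C(Set.Icc 0 T, EuclideanSpace ℝ κ)) :
    C(Set.Icc 0 T, ℝ × EuclideanSpace ℝ κ) :=
  timePath T κ + compLeftCLM _ _ _ (ContinuousLinearMap.inr ℝ ℝ (EuclideanSpace ℝ κ)) w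

theorem timeSpacePath_apply (w : C(Set.Icc 0 T, EuclideanSpace ℝ κ)) (t : Set.Icc 0 T) :
    timeSpacePath w t = (((t : ℝ≥0) : ℝ), w t) := by
  simp [timeSpacePath, timePath]

theorem drivenGrid_eq_eulerGrid {ω : Ω} (hω : Continuous fun t => W t ω)
    (x : EuclideanSpace ℝ ι) {n : ℕ} (hn : n ≤ N) :
    drivenGrid (gridPoint T N) (eulerCoeff T N μ σ)
      (timeSpacePath (pathOf (fun (t : Set.Icc 0 T) => W t) ω)) x n =
      eulerGrid T N μ σ W x ω n := by
  have hp : ∀ t, pathOf (fun (t : Set.Icc 0 T) => W t) ω t = W t ω :=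
    pathOf_apply (hω.comp continuous_subtype_val)
  induction n with
  | zero => rfl
  | succ n ih =>
    -- The truncation of grid points at `T` has no effect because `n + 1 ≤ N`.
    simp only [drivenGrid, eulerGrid, ih (by omega), eulerCoeff, coeffCLM_apply,
      timeSpacePath_apply, hp, gridPoint, min_eq_right (gridTime_le hn),
      min_eq_right (gridTime_le (T := T) (Nat.le_of_succ_le hn)), Prod.fst_sub, Prod.snd_sub]
    rw [add_assoc]

theorem drivenPath_apply_eq_eulerScheme {ω : Ω} (hω : Continuous fun t => W t ω)
    (x : EuclideanSpace ℝ ι) (t : Set.Icc 0 T) :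
    drivenPath (gridPoint T N) (stopAt T N) N (eulerCoeff T N μ σ)
      (timeSpacePath (pathOf (fun (t : Set.Icc 0 T) => W t) ω)) x t =
      eulerScheme T N μ σ W x t ω := by
  have hp : ∀ t, pathOf (fun (t : Set.Icc 0 T) => W t) ω t = W t ω :=
    pathOf_apply (hω.comp continuous_subtype_val)
  simp only [drivenPath, eulerScheme, ContinuousMap.add_apply, ContinuousMap.const_apply,
    ContinuousMap.sum_apply, add_assoc, ← Finset.sum_add_distrib]
  congr 1
  refine Finset.sum_congr rfl fun n hn => ?_
  rw [drivenGrid_eq_eulerGrid hω x (Finset.mem_range.1 hn).le]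
  simp only [compLeftCLM_apply, ContinuousMap.sub_apply, ContinuousMap.comp_apply, eulerCoeff,
    coeffCLM_apply, timeSpacePath_apply, hp, stopAt, ContinuousMap.coe_mk, Prod.fst_sub,
    Prod.snd_sub]

theorem continuous_eulerScheme {ω : Ω} (hω : Continuous fun t => W t ω)
    (x : EuclideanSpace ℝ ι) : Continuous fun t => eulerScheme T N μ σ W x t ω := by
  simp_rw [← drivenPath_apply_eq_eulerScheme hω x]
  exact ContinuousMap.continuous _

theorem pathOf_eulerScheme {ω : Ω} (hω : Continuous fun t => W t ω) (x : EuclideanSpace ℝ ι) :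
    pathOf (eulerScheme T N μ σ W x) ω =
      drivenPath (gridPoint T N) (stopAt T N) N (eulerCoeff T N μ σ)
        (timeSpacePath (pathOf (fun (t : Set.Icc 0 T) => W t) ω)) x := by
  ext1 t
  rw [pathOf_apply (continuous_eulerScheme hω x), drivenPath_apply_eq_eulerScheme hω]

theorem StronglyMeasurable.toLp_mulVec {m : MeasurableSpace Ω} {A : Ω → Matrix ι κ ℝ}
    {v : Ω → EuclideanSpace ℝ κ} (hA : StronglyMeasurable A) (hv : StronglyMeasurable v) :
    StronglyMeasurable fun ω => WithLp.toLp 2 (A ω *ᵥ (v ω).ofLp) := by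
  have h : Continuous fun q : Matrix ι κ ℝ × EuclideanSpace ℝ κ => mulVecCLM ι κ q.1 q.2 :=
    (mulVecCLM ι κ).continuous₂
  exact h.comp_stronglyMeasurable (hA.prodMk hv)

theorem stronglyMeasurable_eulerGrid {P : Measure Ω} {ℱ : Filtration ℝ≥0 mΩ}
    (hW : IsWienerProcess P ℱ W) (hμ : ∀ n < N, Continuous (μ (gridTime T N n)))
    (hσ : ∀ n < N, Continuous (σ (gridTime T N n))) (x : EuclideanSpace ℝ ι) {n : ℕ}
    (hn : n ≤ N) : StronglyMeasurable[ℱ (gridTime T N n)] fun ω => eulerGrid T N μ σ W x ω n := by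
  induction n with
  | zero => exact stronglyMeasurable_const
  | succ n ih =>
    have hle := ℱ.mono (gridTime_mono T N (Nat.le_succ n))
    have h := (ih (by omega)).mono hle
    have hWs : StronglyMeasurable[ℱ (gridTime T N (n + 1))]
        fun ω => W (gridTime T N (n + 1)) ω - W (gridTime T N n) ω :=
      (hW.adapted _).stronglyMeasurable.sub ((hW.adapted _).stronglyMeasurable.mono hle)
    have hm := StronglyMeasurable.toLp_mulVec ((hσ n (by omega)).comp_stronglyMeasurable h) hWs
    have hd := ((hμ n (by omega)).comp_stronglyMeasurable h).fun_const_smul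
      ((gridTime T N (n + 1) : ℝ) - gridTime T N n)
    exact (h.add hd).add hm

theorem stronglyMeasurable_eulerScheme {P : Measure Ω} {ℱ : Filtration ℝ≥0 mΩ}
    (hW : IsWienerProcess P ℱ W) (hμ : ∀ n < N, Continuous (μ (gridTime T N n)))
    (hσ : ∀ n < N, Continuous (σ (gridTime T N n))) (x : EuclideanSpace ℝ ι) (t : Set.Icc 0 T) :
    StronglyMeasurable[ℱ t] (eulerScheme T N μ σ W x t) := by
  have hterm : ∀ n < N, StronglyMeasurable[ℱ t] (fun ω =>
        (((min (t : ℝ≥0) (gridTime T N (n + 1)) : ℝ≥0) : ℝ)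
          - (min (t : ℝ≥0) (gridTime T N n) : ℝ≥0)) •
            μ (gridTime T N n) (eulerGrid T N μ σ W x ω n)) ∧
      StronglyMeasurable[ℱ t] (fun ω =>
        WithLp.toLp 2 (σ (gridTime T N n) (eulerGrid T N μ σ W x ω n) *ᵥ
          (W (min t (gridTime T N (n + 1))) ω - W (min t (gridTime T N n)) ω).ofLp)) := by
    intro n hn
    -- For `t ≤ t_n` the coefficients need not be `ℱ t`-measurable, but both minima equal `t` and
    -- the summand vanishes. Otherwise `ℱ (t_n)` is contained in `ℱ t`.
    rcases le_total (t : ℝ≥0) (gridTime T N n) with h | h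
    · have h' := h.trans (gridTime_mono T N (Nat.le_succ n))
      rw [min_eq_left h, min_eq_left h']
      simp only [sub_self, zero_smul, WithLp.ofLp_zero, Matrix.mulVec_zero]
      exact ⟨stronglyMeasurable_const, stronglyMeasurable_const⟩
    · have he := (stronglyMeasurable_eulerGrid hW hμ hσ x hn.le).mono (ℱ.mono h)
      have hWm : ∀ s, StronglyMeasurable[ℱ t] (W (min t s)) := fun s =>
        (hW.adapted _).stronglyMeasurable.mono (ℱ.mono (min_le_left _ _))
      exact ⟨((hμ n hn).comp_stronglyMeasurable he).fun_const_smul _,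
        StronglyMeasurable.toLp_mulVec ((hσ n hn).comp_stronglyMeasurable he)
          ((hWm _).sub (hWm _))⟩
  exact (stronglyMeasurable_const.add (Finset.stronglyMeasurable_fun_sum _ fun n hn =>
    (hterm n (Finset.mem_range.1 hn)).1)).add (Finset.stronglyMeasurable_fun_sum _ fun n hn =>
    (hterm n (Finset.mem_range.1 hn)).2)

/-- This turns polynomial bounds in the driving path into `L^p` bounds: the `k`-th power is in `L^p`
if the base is in `L^(p k)`. -/
theorem memLp_one_add_norm_pow {E : Type*} [NormedAddCommGroup E] {P : Measure Ω}
    [IsFiniteMeasure P] {Y : Ω → E} (hY : ∀ p : ℝ≥0∞, p ≠ ∞ → MemLp Y p P) (k : ℕ) {p : ℝ≥0∞}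
    (hp : p ≠ ∞) : MemLp (fun ω => (1 + ‖Y ω‖) ^ k) p P := by
  rcases eq_or_ne k 0 with rfl | hk
  · simpa using memLp_const (1 : ℝ)
  have h : MemLp (fun ω => 1 + ‖Y ω‖) (p * k) P :=
    (memLp_const (1 : ℝ)).add (hY _ (ENNReal.mul_ne_top hp (by simp))).norm
  have h2 := h.norm_rpow_div k
  rw [ENNReal.mul_div_cancel_right (by exact_mod_cast hk) (by simp)] at h2
  refine h2.congr_norm (by exact (h2.aestronglyMeasurable.congr (.of_forall fun ω => by
    simp [abs_of_nonneg (add_nonneg zero_le_one (norm_nonneg (Y ω)))]))) (.of_forall fun ω => by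
    simp [abs_of_nonneg (add_nonneg zero_le_one (norm_nonneg (Y ω)))])

theorem IsWienerProcess.memLp_timeSpacePath {P : Measure Ω} [IsProbabilityMeasure P]
    {ℱ : Filtration ℝ≥0 mΩ} (hℱ : UsualConditions P ℱ) (hW : IsWienerProcess P ℱ W) (hT : 0 < T)
    {p : ℝ≥0∞} (hp : p ≠ ∞) :
    MemLp (fun ω => timeSpacePath (pathOf (fun (t : Set.Icc 0 T) => W t) ω)) p P := by
  have h := (compLeftCLM (Set.Icc 0 T) _ _
    (ContinuousLinearMap.inr ℝ ℝ (EuclideanSpace ℝ κ))).comp_memLp' (hW.memLp_pathOf hℱ hT hp)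
  exact (memLp_const (timePath T κ)).add h

theorem exists_norm_eulerCoeff_le {n : ℕ}
    (hμ : ∃ C, ∀ x, ‖μ (gridTime T N n) x‖ ≤ C * (1 + ‖x‖))
    (hσ : ∃ C, ∀ x, ‖σ (gridTime T N n) x‖ ≤ C * (1 + ‖x‖)) :
    ∃ C, ∀ x, ‖eulerCoeff T N μ σ n x‖ ≤ C * (1 + ‖x‖) := by
  obtain ⟨C, hC⟩ := hμ
  obtain ⟨C', hC'⟩ := hσ
  refine ⟨‖coeffCLM ι κ‖ * max C C', fun x => ?_⟩
  rw [mul_assoc]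
  refine (coeffCLM ι κ).le_of_opNorm_le_of_le le_rfl (norm_prod_le_iff.2 ⟨?_, ?_⟩)
  · exact (hC x).trans (by gcongr; exact le_max_left _ _)
  · exact (hC' x).trans (by gcongr; exact le_max_right _ _)

/-- The Euler scheme with continuous coefficients of linear growth has moments of all orders. -/
theorem memEInf_eulerScheme {P : Measure Ω} [IsProbabilityMeasure P]
    {ℱ : Filtration ℝ≥0 mΩ} (hℱ : UsualConditions P ℱ) (hW : IsWienerProcess P ℱ W) (hT : 0 < T)
    (hμ : ∀ n < N, Continuous (μ (gridTime T N n)))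
    (hσ : ∀ n < N, Continuous (σ (gridTime T N n)))
    (hμ' : ∀ n < N, ∃ C, ∀ x, ‖μ (gridTime T N n) x‖ ≤ C * (1 + ‖x‖))
    (hσ' : ∀ n < N, ∃ C, ∀ x, ‖σ (gridTime T N n) x‖ ≤ C * (1 + ‖x‖))
    (x : EuclideanSpace ℝ ι) : MemEInf P ℱ (eulerScheme T N μ σ W x) := by
  intro p _ hp
  have hY := fun (p : ℝ≥0∞) (hp : p ≠ ∞) => hW.memLp_timeSpacePath hℱ hT hp
  have hpath : (fun ω => drivenPath (gridPoint T N) (stopAt T N) N (eulerCoeff T N μ σ)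
      (timeSpacePath (pathOf (fun (t : Set.Icc 0 T) => W t) ω)) x) =ᵐ[P]
      pathOf (eulerScheme T N μ σ W x) := by
    filter_upwards [hW.continuous_paths] with ω hω
    exact (pathOf_eulerScheme hω x).symm
  refine ⟨?_, stronglyMeasurable_eulerScheme hW hμ hσ x, ?_⟩
  · filter_upwards [hW.continuous_paths] with ω hω
    exact continuous_eulerScheme hω x
  · have hF' : ∀ n < N, ∃ C, ∀ x, ‖eulerCoeff T N μ σ n x‖ ≤ C * (1 + ‖x‖) := fun n hn =>
      exists_norm_eulerCoeff_le (hμ' n hn) (hσ' n hn)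
    obtain ⟨C, k, h⟩ := exists_norm_drivenPath_le (τ := gridPoint T N) (c := stopAt T N) hF' x
    refine MemLp.ae_eq hpath ?_
    refine ((memLp_one_add_norm_pow hY k hp).const_mul C).mono' ?_ (.of_forall fun ω => h _)
    have hF : ∀ n < N, Continuous (eulerCoeff T N μ σ n) := fun n hn =>
      (coeffCLM ι κ).continuous.comp ((hμ n hn).prodMk (hσ n hn))
    -- Measurability comes from writing the path of the scheme as a continuous functional of the
    -- driving path.
    exact (continuous_drivenPath hF x).comp_aestronglyMeasurable (hY p hp).1

end Euler

/-! ### Pathwise derivative and the augmented Euler scheme -/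

section AugmentedEuler

attribute [local instance] frobeniusTopology

variable {Ω ι κ : Type*} {mΩ : MeasurableSpace Ω} [Fintype ι] [Fintype κ] {T : ℝ≥0} {N : ℕ}
  {μ : ℝ≥0 → EuclideanSpace ℝ ι → EuclideanSpace ℝ ι}
  {σ : ℝ≥0 → EuclideanSpace ℝ ι → Matrix ι κ ℝ} {W : ℝ≥0 → Ω → EuclideanSpace ℝ κ}

/-- Stacking of two matrices, as a continuous linear map. -/
noncomputable def fromRowsCLM (ι κ : Type*) [Fintype ι] [Fintype κ] :
    Matrix ι κ ℝ × Matrix ι κ ℝ →L[ℝ] Matrix (ι ⊕ ι) κ ℝ :=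
  LinearMap.toContinuousLinearMap
    { toFun := fun A => Matrix.fromRows A.1 A.2
      map_add' := fun A B => by ext (i | i) j <;> simp
      map_smul' := fun c A => by ext (i | i) j <;> simp }

theorem sumEquivProd_toLp_fromRows_mulVec (A : Matrix ι κ ℝ × Matrix ι κ ℝ)
    (v : EuclideanSpace ℝ κ) :
    EuclideanSpace.sumEquivProd (𝕜 := ℝ)
        (WithLp.toLp 2 (Matrix.fromRows A.1 A.2 *ᵥ v.ofLp)) =
      Prod.map ((mulVecCLM ι κ).flip v) ((mulVecCLM ι κ).flip v) A := by
  rw [Matrix.fromRows_mulVec]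
  rfl

theorem augDeriv_const_smul_comp {B : Type*} [NormedAddCommGroup B] [NormedSpace ℝ B]
    {f e : B → B} (hf : Differentiable ℝ f) (he : Differentiable ℝ e) (c : ℝ) (z : B × B) :
    augDeriv (fun x => c • f (e x)) z = c • augDeriv f (augDeriv e z) := by
  have h := augDeriv_clm_comp (c • ContinuousLinearMap.id ℝ B) (f := fun x => f (e x))
    (hf.comp he) z
  rw [augDeriv_comp hf he] at h
  exact h

theorem augDeriv_mulVec_comp {g : EuclideanSpace ℝ ι → Matrix ι κ ℝ}
    {e : EuclideanSpace ℝ ι → EuclideanSpace ℝ ι} (hg : Differentiable ℝ g)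
    (he : Differentiable ℝ e) (v : EuclideanSpace ℝ κ)
    (z : EuclideanSpace ℝ ι × EuclideanSpace ℝ ι) :
    augDeriv (fun x => (WithLp.toLp 2 (g (e x) *ᵥ v.ofLp) : EuclideanSpace ℝ ι)) z =
      Prod.map ((mulVecCLM ι κ).flip v) ((mulVecCLM ι κ).flip v)
        (augDeriv g (augDeriv e z)) := by
  have h := augDeriv_clm_comp ((mulVecCLM ι κ).flip v) (f := fun x => g (e x)) (hg.comp he) z
  rw [augDeriv_comp hg he] at h
  exact h

theorem differentiable_toLp_mulVec {g : EuclideanSpace ℝ ι → Matrix ι κ ℝ}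
    {e : EuclideanSpace ℝ ι → EuclideanSpace ℝ ι} (hg : Differentiable ℝ g)
    (he : Differentiable ℝ e) (v : EuclideanSpace ℝ κ) :
    Differentiable ℝ fun x => (WithLp.toLp 2 (g (e x) *ᵥ v.ofLp) : EuclideanSpace ℝ ι) :=
  ((mulVecCLM ι κ).flip v).differentiable.comp (hg.comp he)

theorem differentiable_eulerGrid (hμ : ∀ n < N, Differentiable ℝ (μ (gridTime T N n)))
    (hσ : ∀ n < N, Differentiable ℝ (σ (gridTime T N n))) (ω : Ω) {n : ℕ} (hn : n ≤ N) :
    Differentiable ℝ fun x => eulerGrid T N μ σ W x ω n := by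
  induction n with
  | zero => exact differentiable_id
  | succ n ih =>
    have he := ih (by omega)
    have hd : Differentiable ℝ fun x => ((gridTime T N (n + 1) : ℝ) - gridTime T N n) •
        μ (gridTime T N n) (eulerGrid T N μ σ W x ω n) :=
      ((hμ n (by omega)).comp he).fun_const_smul _
    have hv := differentiable_toLp_mulVec (hσ n (by omega)) he
      (W (gridTime T N (n + 1)) ω - W (gridTime T N n) ω)
    exact (he.add hd).add hv

/-- The augmented derivative commutes with every operation of the Euler step, so both sides obey the
same recursion from the same initial value. This is algebra for each outcome; no path regularity
enters. -/
theorem sumEquivProd_eulerGrid (hμ : ∀ n < N, Differentiable ℝ (μ (gridTime T N n)))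
    (hσ : ∀ n < N, Differentiable ℝ (σ (gridTime T N n))) (ω : Ω) {n : ℕ} (hn : n ≤ N)
    (z : EuclideanSpace ℝ (ι ⊕ ι)) :
    EuclideanSpace.sumEquivProd (𝕜 := ℝ)
        (eulerGrid T N (augDrift μ) (augDiffusion σ) W z ω n) =
      augDeriv (fun x => eulerGrid T N μ σ W x ω n) (EuclideanSpace.sumEquivProd z) := by
  induction n with
  | zero => exact (augDeriv_id _).symm
  | succ n ih =>
    have hμn := hμ n (by omega)
    have hσn := hσ n (by omega)
    have he := differentiable_eulerGrid (W := W) hμ hσ ω (Nat.le_of_succ_le hn)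
    have hd : Differentiable ℝ fun x => ((gridTime T N (n + 1) : ℝ) - gridTime T N n) •
        μ (gridTime T N n) (eulerGrid T N μ σ W x ω n) := (hμn.comp he).fun_const_smul _
    have hv := differentiable_toLp_mulVec hσn he
      (W (gridTime T N (n + 1)) ω - W (gridTime T N n) ω)
    simp only [eulerGrid]
    rw [augDeriv_add (he.fun_add hd) hv, augDeriv_add he hd, augDeriv_mulVec_comp hσn he,
      augDeriv_const_smul_comp hμn he, ← ih (by omega), map_add, map_add, map_smul, augDrift,
      ContinuousLinearEquiv.apply_symm_apply, augDiffusion, sumEquivProd_toLp_fromRows_mulVec]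

theorem sumEquivProd_eulerScheme (hμ : ∀ n < N, Differentiable ℝ (μ (gridTime T N n)))
    (hσ : ∀ n < N, Differentiable ℝ (σ (gridTime T N n))) (ω : Ω) (t : Set.Icc 0 T)
    (z : EuclideanSpace ℝ (ι ⊕ ι)) :
    EuclideanSpace.sumEquivProd (𝕜 := ℝ)
        (eulerScheme T N (augDrift μ) (augDiffusion σ) W z t ω) =
      augDeriv (fun x => eulerScheme T N μ σ W x t ω) (EuclideanSpace.sumEquivProd z) := by
  have he : ∀ n ∈ Finset.range N, Differentiable ℝ fun x => eulerGrid T N μ σ W x ω n :=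
    fun n hn => differentiable_eulerGrid hμ hσ ω (Finset.mem_range.1 hn).le
  have hd : ∀ n ∈ Finset.range N, Differentiable ℝ fun x =>
      (((min (t : ℝ≥0) (gridTime T N (n + 1)) : ℝ≥0) : ℝ)
        - (min (t : ℝ≥0) (gridTime T N n) : ℝ≥0)) •
          μ (gridTime T N n) (eulerGrid T N μ σ W x ω n) :=
    fun n hn => ((hμ n (Finset.mem_range.1 hn)).comp (he n hn)).fun_const_smul _
  have hv : ∀ n ∈ Finset.range N, Differentiable ℝ fun x =>
      (WithLp.toLp 2 (σ (gridTime T N n) (eulerGrid T N μ σ W x ω n) *ᵥ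
        (W (min t (gridTime T N (n + 1))) ω - W (min t (gridTime T N n)) ω).ofLp) :
          EuclideanSpace ℝ ι) :=
    fun n hn => differentiable_toLp_mulVec (hσ n (Finset.mem_range.1 hn)) (he n hn) _
  simp only [eulerScheme]
  rw [augDeriv_add (differentiable_fun_id.fun_add (Differentiable.fun_sum hd))
    (Differentiable.fun_sum hv), augDeriv_add differentiable_fun_id (Differentiable.fun_sum hd),
    augDeriv_sum hd, augDeriv_sum hv, augDeriv_id, map_add, map_add, map_sum, map_sum]
  refine congrArg₂ (· + ·) (congrArg _ ?_) ?_
  · refine Finset.sum_congr rfl fun n hn => ?_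
    have hn' := Finset.mem_range.1 hn
    rw [augDeriv_const_smul_comp (hμ n hn') (he n hn), map_smul, augDrift,
      ContinuousLinearEquiv.apply_symm_apply, sumEquivProd_eulerGrid hμ hσ ω hn'.le]
  · refine Finset.sum_congr rfl fun n hn => ?_
    have hn' := Finset.mem_range.1 hn
    rw [augDeriv_mulVec_comp (hσ n hn') (he n hn), augDiffusion,
      sumEquivProd_toLp_fromRows_mulVec, sumEquivProd_eulerGrid hμ hσ ω hn'.le]

theorem RegularCoefficient.differentiable {B₁ B₂ : Type*} [NormedAddCommGroup B₁]
    [NormedSpace ℝ B₁] [NormedAddCommGroup B₂] [NormedSpace ℝ B₂] {h : ℝ≥0 → B₁ → B₂}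
    (hh : RegularCoefficient T h) {t : ℝ≥0} (ht : t ≤ T) : Differentiable ℝ (h t) :=
  (hh.contDiff_space t ⟨zero_le, ht⟩).differentiable one_ne_zero

theorem RegularCoefficient.exists_lipschitzWith {B₁ B₂ : Type*} [NormedAddCommGroup B₁]
    [NormedSpace ℝ B₁] [NormedAddCommGroup B₂] [NormedSpace ℝ B₂] {h : ℝ≥0 → B₁ → B₂}
    (hh : RegularCoefficient T h) {t : ℝ≥0} (ht : t ≤ T) : ∃ C, LipschitzWith C (h t) := by
  obtain ⟨C, hC⟩ := hh.bounded_deriv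
  exact ⟨C.toNNReal, lipschitzWith_of_nnnorm_fderiv_le (hh.differentiable ht) fun x =>
    NNReal.le_toNNReal_of_coe_le (hC t ⟨zero_le, ht⟩ x)⟩

theorem RegularCoefficient.exists_norm_augDeriv_le {B₁ B₂ : Type*} [NormedAddCommGroup B₁]
    [NormedSpace ℝ B₁] [NormedAddCommGroup B₂] [NormedSpace ℝ B₂] {h : ℝ≥0 → B₁ → B₂}
    (hh : RegularCoefficient T h) {t : ℝ≥0} (ht : t ≤ T) :
    ∃ C, 0 ≤ C ∧ ∀ z, ‖augDeriv (h t) z‖ ≤ C * (1 + ‖z‖) := by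
  obtain ⟨C, hC⟩ := hh.bounded_deriv
  have hC0 : 0 ≤ C := (norm_nonneg _).trans (hC t ⟨zero_le, ht⟩ 0)
  refine ⟨‖h t 0‖ + C, by positivity, fun z =>
    (norm_augDeriv_le (hh.differentiable ht) (hC t ⟨zero_le, ht⟩) z).trans ?_⟩
  nlinarith [norm_nonneg z, norm_nonneg (h t 0), mul_nonneg (norm_nonneg (h t 0)) (norm_nonneg z)]

theorem RegularCoefficient.exists_norm_le {B₁ B₂ : Type*} [NormedAddCommGroup B₁]
    [NormedSpace ℝ B₁] [NormedAddCommGroup B₂] [NormedSpace ℝ B₂] {h : ℝ≥0 → B₁ → B₂}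
    (hh : RegularCoefficient T h) {t : ℝ≥0} (ht : t ≤ T) :
    ∃ C, ∀ x, ‖h t x‖ ≤ C * (1 + ‖x‖) := by
  obtain ⟨C, -, hC⟩ := hh.exists_norm_augDeriv_le ht
  refine ⟨C, fun x => ?_⟩
  have h1 := (norm_fst_le _).trans (hC (x, 0))
  simpa [augDeriv] using h1

/-- The maps `L` and `M` stand for the identifications with `ℝ²ᵈ` and for the stacking of matrices,
so that drift and diffusion are treated at once. -/
theorem RegularCoefficient.exists_norm_clm_augDeriv_le {V₁ B₁ B₂ B₃ : Type*}
    [NormedAddCommGroup V₁] [NormedSpace ℝ V₁] [NormedAddCommGroup B₁]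
    [NormedSpace ℝ B₁] [NormedAddCommGroup B₂] [NormedSpace ℝ B₂] [NormedAddCommGroup B₃]
    [NormedSpace ℝ B₃] {h : ℝ≥0 → B₁ → B₂} (hh : RegularCoefficient T h) {t : ℝ≥0} (ht : t ≤ T)
    (L : V₁ →L[ℝ] B₁ × B₁) (M : B₂ × B₂ →L[ℝ] B₃) :
    ∃ C, ∀ z, ‖M (augDeriv (h t) (L z))‖ ≤ C * (1 + ‖z‖) := by
  obtain ⟨C, hC0, hC⟩ := hh.exists_norm_augDeriv_le ht
  refine ⟨‖M‖ * (C * (1 + ‖L‖)), fun z => ?_⟩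
  rw [mul_assoc, mul_assoc]
  refine M.le_of_opNorm_le_of_le le_rfl ((hC _).trans ?_)
  gcongr
  nlinarith [L.le_opNorm z, norm_nonneg z, norm_nonneg L]

theorem memEInf_augmented_eulerScheme {P : Measure Ω} [IsProbabilityMeasure P]
    {ℱ : Filtration ℝ≥0 mΩ} (hℱ : UsualConditions P ℱ) (hW : IsWienerProcess P ℱ W) (hT : 0 < T)
    (hμ : RegularCoefficient T μ) (hσ : RegularCoefficient T σ) (z : EuclideanSpace ℝ (ι ⊕ ι)) :
    MemEInf P ℱ (eulerScheme T N (augDrift μ) (augDiffusion σ) W z) := by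
  have ht : ∀ n < N, gridTime T N n ≤ T := fun n hn => gridTime_le hn.le
  let e : EuclideanSpace ℝ (ι ⊕ ι) →L[ℝ] EuclideanSpace ℝ ι × EuclideanSpace ℝ ι :=
    EuclideanSpace.sumEquivProd.toContinuousLinearMap
  let e' : EuclideanSpace ℝ ι × EuclideanSpace ℝ ι →L[ℝ] EuclideanSpace ℝ (ι ⊕ ι) :=
    EuclideanSpace.sumEquivProd.symm.toContinuousLinearMap
  refine memEInf_eulerScheme hℱ hW hT (fun n hn => ?_) (fun n hn => ?_) (fun n hn => ?_)
    (fun n hn => ?_) z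
  · exact e'.continuous.comp ((continuous_augDeriv
      (hμ.contDiff_space _ ⟨zero_le, ht n hn⟩)).comp e.continuous)
  · exact (fromRowsCLM ι κ).continuous.comp ((continuous_augDeriv
      (hσ.contDiff_space _ ⟨zero_le, ht n hn⟩)).comp e.continuous)
  · exact hμ.exists_norm_clm_augDeriv_le (ht n hn) e e'
  · exact hσ.exists_norm_clm_augDeriv_le (ht n hn) e (fromRowsCLM ι κ)

theorem RegularCoefficient.memEInf_eulerScheme {P : Measure Ω} [IsProbabilityMeasure P]
    {ℱ : Filtration ℝ≥0 mΩ} (hℱ : UsualConditions P ℱ) (hW : IsWienerProcess P ℱ W) (hT : 0 < T)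
    (hμ : RegularCoefficient T μ) (hσ : RegularCoefficient T σ) (x : EuclideanSpace ℝ ι) :
    MemEInf P ℱ (eulerScheme T N μ σ W x) := by
  have ht : ∀ n < N, gridTime T N n ≤ T := fun n hn => gridTime_le hn.le
  exact _root_.memEInf_eulerScheme hℱ hW hT (fun n hn => (hμ.differentiable (ht n hn)).continuous)
    (fun n hn => (hσ.differentiable (ht n hn)).continuous)
    (fun n hn => hμ.exists_norm_le (ht n hn)) (fun n hn => hσ.exists_norm_le (ht n hn)) x

theorem differentiable_eulerCoeff (hμ : RegularCoefficient T μ) (hσ : RegularCoefficient T σ)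
    {n : ℕ} (hn : n < N) : Differentiable ℝ (eulerCoeff T N μ σ n) :=
  (coeffCLM ι κ).differentiable.comp
    ((hμ.differentiable (gridTime_le hn.le)).prodMk (hσ.differentiable (gridTime_le hn.le)))

theorem exists_lipschitzWith_eulerCoeff (hμ : RegularCoefficient T μ)
    (hσ : RegularCoefficient T σ) {n : ℕ} (hn : n < N) :
    ∃ C, LipschitzWith C (eulerCoeff T N μ σ n) := by
  obtain ⟨C, hC⟩ := hμ.exists_lipschitzWith (gridTime_le hn.le)
  obtain ⟨C', hC'⟩ := hσ.exists_lipschitzWith (gridTime_le hn.le)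
  exact ⟨_, (coeffCLM ι κ).lipschitz.comp (hC.prodMk hC')⟩

/-- The paths of the Euler scheme depend differentiably on the initial value. -/
theorem differentiable_pathOf_eulerScheme (hμ : RegularCoefficient T μ)
    (hσ : RegularCoefficient T σ) {ω : Ω} (hω : Continuous fun t => W t ω) :
    Differentiable ℝ fun x => pathOf (eulerScheme T N μ σ W x) ω := by
  simp_rw [pathOf_eulerScheme hω]
  exact differentiable_drivenPath (fun n hn => differentiable_eulerCoeff hμ hσ hn) _

/-- Evaluation at `t` is continuous and linear, hence commutes with differentiation. This links the
derivative in path space to the derivatives at single times, where the augmented scheme is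
identified. -/
theorem fderiv_pathOf_eulerScheme_apply (hμ : RegularCoefficient T μ)
    (hσ : RegularCoefficient T σ) {ω : Ω} (hω : Continuous fun t => W t ω)
    (x h : EuclideanSpace ℝ ι) (t : Set.Icc 0 T) :
    fderiv ℝ (fun x => pathOf (eulerScheme T N μ σ W x) ω) x h t =
      fderiv ℝ (fun x => eulerScheme T N μ σ W x t ω) x h := by
  let L : C(Set.Icc 0 T, EuclideanSpace ℝ ι) →L[ℝ] EuclideanSpace ℝ ι := ContinuousMap.evalCLM ℝ t
  have h1 : HasFDerivAt (fun x => L (pathOf (eulerScheme T N μ σ W x) ω))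
      (L.comp (fderiv ℝ (fun x => pathOf (eulerScheme T N μ σ W x) ω) x)) x :=
    L.hasFDerivAt.comp x (differentiable_pathOf_eulerScheme hμ hσ hω x).hasFDerivAt
  have h2 : (fun x => L (pathOf (eulerScheme T N μ σ W x) ω)) =
      fun x => eulerScheme T N μ σ W x t ω :=
    funext fun x => pathOf_apply (continuous_eulerScheme hω x) t
  rw [← h2, h1.fderiv]
  rfl

/-- The exceptional null set is the same for all `t`, as needed to compare elements of the path
space. -/
theorem ae_sumEquivProd_augmented_eulerScheme {P : Measure Ω} {ℱ : Filtration ℝ≥0 mΩ}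
    (hW : IsWienerProcess P ℱ W) (hμ : RegularCoefficient T μ) (hσ : RegularCoefficient T σ)
    {p : ℝ≥0∞} (z : EuclideanSpace ℝ (ι ⊕ ι))
    (hz : MemCAd P ℱ p (eulerScheme T N (augDrift μ) (augDiffusion σ) W z)) :
    ∀ᵐ ω ∂P, ∀ t, EuclideanSpace.sumEquivProd (𝕜 := ℝ) ((CAd.mk _ hz).1 ω t) =
      augDeriv (fun x => eulerScheme T N μ σ W x t ω) (EuclideanSpace.sumEquivProd z) := by
  filter_upwards [hz.memLp.coeFn_toLp, hW.continuous_paths] with ω h1 hω t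
  rw [← sumEquivProd_eulerScheme (fun n hn => hμ.differentiable (gridTime_le hn.le))
    (fun n hn => hσ.differentiable (gridTime_le hn.le)),
    ← pathOf_apply (continuous_eulerScheme hω z)]
  exact congrArg (fun f => EuclideanSpace.sumEquivProd (𝕜 := ℝ) (f t)) h1

/-- The Euler scheme is Lipschitz in the initial value, with a random Lipschitz constant that has
moments of all orders. -/
theorem exists_memLp_lipschitz_eulerScheme {P : Measure Ω} [IsProbabilityMeasure P]
    {ℱ : Filtration ℝ≥0 mΩ} (hℱ : UsualConditions P ℱ) (hW : IsWienerProcess P ℱ W) (hT : 0 < T)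
    (hμ : RegularCoefficient T μ) (hσ : RegularCoefficient T σ) {p : ℝ≥0∞} (hp : p ≠ ∞) :
    ∃ L : Ω → ℝ, MemLp L p P ∧ ∀ᵐ ω ∂P, 0 ≤ L ω ∧ ∀ x x',
      ‖pathOf (eulerScheme T N μ σ W x) ω - pathOf (eulerScheme T N μ σ W x') ω‖ ≤
        L ω * ‖x - x'‖ := by
  have hF : ∀ n < N, ∃ C, LipschitzWith C (eulerCoeff T N μ σ n) := fun n hn =>
    exists_lipschitzWith_eulerCoeff hμ hσ hn
  obtain ⟨C, k, hC, h⟩ := exists_norm_drivenPath_sub_le (τ := gridPoint T N) (c := stopAt T N) hF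
  have hY := fun (p : ℝ≥0∞) (hp : p ≠ ∞) => hW.memLp_timeSpacePath hℱ hT hp
  refine ⟨_, (memLp_one_add_norm_pow hY k hp).const_mul C, ?_⟩
  filter_upwards [hW.continuous_paths] with ω hω
  refine ⟨by positivity, fun x x' => ?_⟩
  rw [pathOf_eulerScheme hω, pathOf_eulerScheme hω]
  exact h x x' _

end AugmentedEuler

/-! ### Differentiability as a map into adapted processes -/

section Differentiability

variable {Ω : Type*} {mΩ : MeasurableSpace Ω} {P : Measure Ω} {ℱ : Filtration ℝ≥0 mΩ} {T : ℝ≥0}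
  {V : Type*} [NormedAddCommGroup V] [NormedSpace ℝ V] {p : ℝ≥0∞}

theorem CAd.coeFn_mk {X : Set.Icc 0 T → Ω → V} (hX : MemCAd P ℱ p X) :
    (CAd.mk X hX).1 =ᵐ[P] pathOf X :=
  hX.memLp.coeFn_toLp

/-- A family of processes whose paths are almost surely differentiable in the parameter, with an
`L^p` Lipschitz constant, is differentiable as a map into `CAd`. -/
theorem CAd.exists_hasFDerivAt [Fact (1 ≤ p)] (hp : p ≠ ∞) {B : Type*} [NormedAddCommGroup B]
    [NormedSpace ℝ B] [FiniteDimensional ℝ B] {F Y : B → CAd P ℱ T V p} {x₀ : B}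
    {f : B → Ω → C(Set.Icc 0 T, V)} {D : Ω → B →L[ℝ] C(Set.Icc 0 T, V)} {L : Ω → ℝ}
    (hL : MemLp L p P) (hF : ∀ x, (F x).1 =ᵐ[P] f x) (hY : ∀ h, (Y h).1 =ᵐ[P] fun ω => D ω h)
    (hD : ∀ᵐ ω ∂P, HasFDerivAt (fun x => f x ω) (D ω) x₀)
    (hlip : ∀ᵐ ω ∂P, 0 ≤ L ω ∧ ∀ x, ‖f x ω - f x₀ ω‖ ≤ L ω * ‖x - x₀‖) :
    ∃ F' : B →L[ℝ] CAd P ℱ T V p, HasFDerivAt F F' x₀ ∧ ∀ h, F' h = Y h := by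
  -- Linearity of `Y` is inherited from that of `D ω`, outside a null set for each fixed choice of
  -- arguments. Continuity is automatic in finite dimension.
  let A : B →ₗ[ℝ] CAd P ℱ T V p :=
    { toFun := Y
      map_add' := fun h k => by
        refine Subtype.ext (Lp.ext ?_)
        filter_upwards [hY h, hY k, hY (h + k), Lp.coeFn_add (Y h).1 (Y k).1] with ω h1 h2 h3 h4
        rw [h3, map_add]
        exact (h4.trans (congrArg₂ (· + ·) h1 h2)).symm
      map_smul' := fun c h => by
        refine Subtype.ext (Lp.ext ?_)
        filter_upwards [hY h, hY (c • h), Lp.coeFn_smul c (Y h).1] with ω h1 h2 h3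
        rw [h2, map_smul]
        exact (h3.trans (congrArg (c • ·) h1)).symm }
  refine ⟨LinearMap.toContinuousLinearMap A, ?_, fun h => rfl⟩
  rw [hasFDerivAt_iff_tendsto]
  -- The norm of `CAd` is that of the ambient `Lp`, so the remainder estimate there is the required
  -- one.
  have h := Lp.tendsto_remainder_of_ae_hasFDerivAt hp (F := fun x => (F x).1)
    (Y := fun h => (Y h).1) hL hF hY hD hlip
  exact h

end Differentiability

/-! ### Identification of the derivative and conclusion -/

section AugmentedEulerDerivative

variable {Ω ι κ : Type*} {mΩ : MeasurableSpace Ω} [Fintype ι] [Fintype κ] {T : ℝ≥0} {N : ℕ}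
  {μ : ℝ≥0 → EuclideanSpace ℝ ι → EuclideanSpace ℝ ι}
  {σ : ℝ≥0 → EuclideanSpace ℝ ι → Matrix ι κ ℝ} {W : ℝ≥0 → Ω → EuclideanSpace ℝ κ}
  {P : Measure Ω} {ℱ : Filtration ℝ≥0 mΩ} {p : ℝ≥0∞}
  {F : EuclideanSpace ℝ ι → CAd P ℱ T (EuclideanSpace ℝ ι) p}
  {Z : EuclideanSpace ℝ (ι ⊕ ι) → CAd P ℱ T (EuclideanSpace ℝ (ι ⊕ ι)) p}

/-- The second component `ℝ²ⁿ → ℝⁿ` of the identification of `ℝ²ⁿ` with `ℝⁿ × ℝⁿ`. -/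
noncomputable def sumSndCLM (ι : Type*) [Fintype ι] :
    EuclideanSpace ℝ (ι ⊕ ι) →L[ℝ] EuclideanSpace ℝ ι :=
  (ContinuousLinearMap.snd ℝ (EuclideanSpace ℝ ι) (EuclideanSpace ℝ ι)).comp
    (EuclideanSpace.sumEquivProd (𝕜 := ℝ) (ι := ι) (κ := ι) : EuclideanSpace ℝ (ι ⊕ ι) →L[ℝ] _)

/-- The first component `ℝ²ⁿ → ℝⁿ` of the identification of `ℝ²ⁿ` with `ℝⁿ × ℝⁿ`. -/
noncomputable def sumFstCLM (ι : Type*) [Fintype ι] :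
    EuclideanSpace ℝ (ι ⊕ ι) →L[ℝ] EuclideanSpace ℝ ι :=
  (ContinuousLinearMap.fst ℝ (EuclideanSpace ℝ ι) (EuclideanSpace ℝ ι)).comp
    (EuclideanSpace.sumEquivProd (𝕜 := ℝ) (ι := ι) (κ := ι) : EuclideanSpace ℝ (ι ⊕ ι) →L[ℝ] _)

/-- The second half of the augmented scheme is an adapted `L^p` process that represents the pathwise
derivative; it is the candidate for the Fréchet derivative. -/
theorem map_sumSndCLM_ae_eq [Fact (1 ≤ p)] (hW : IsWienerProcess P ℱ W)
    (hμ : RegularCoefficient T μ) (hσ : RegularCoefficient T σ)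
    (hZ : ∀ z, ∀ᵐ ω ∂P, ∀ t, EuclideanSpace.sumEquivProd (𝕜 := ℝ) ((Z z).1 ω t) =
      augDeriv (fun x => eulerScheme T N μ σ W x t ω) (EuclideanSpace.sumEquivProd z))
    (x h : EuclideanSpace ℝ ι) :
    (CAd.map (sumSndCLM ι) (Z (EuclideanSpace.sumEquivProd.symm (x, h)))).1 =ᵐ[P]
      fun ω => fderiv ℝ (fun x => pathOf (eulerScheme T N μ σ W x) ω) x h := by
  filter_upwards [hZ (EuclideanSpace.sumEquivProd.symm (x, h)), CAd.coeFn_map (sumSndCLM ι)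
    (Z (EuclideanSpace.sumEquivProd.symm (x, h))), hW.continuous_paths] with ω h1 h2 hω
  ext1 t
  refine (h2 t).trans ?_
  have h3 := congrArg Prod.snd (h1 t)
  rw [ContinuousLinearEquiv.apply_symm_apply] at h3
  exact h3.trans (fderiv_pathOf_eulerScheme_apply hμ hσ hω x h t).symm

theorem exists_hasFDerivAt_eulerScheme [IsProbabilityMeasure P] [Fact (1 ≤ p)] (hp : p ≠ ∞)
    (hℱ : UsualConditions P ℱ) (hW : IsWienerProcess P ℱ W) (hT : 0 < T)
    (hμ : RegularCoefficient T μ) (hσ : RegularCoefficient T σ)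
    (hF : ∀ x, (F x).1 =ᵐ[P] pathOf (eulerScheme T N μ σ W x))
    (hZ : ∀ z, ∀ᵐ ω ∂P, ∀ t, EuclideanSpace.sumEquivProd (𝕜 := ℝ) ((Z z).1 ω t) =
      augDeriv (fun x => eulerScheme T N μ σ W x t ω) (EuclideanSpace.sumEquivProd z))
    (x₀ : EuclideanSpace ℝ ι) :
    ∃ F' : EuclideanSpace ℝ ι →L[ℝ] CAd P ℱ T (EuclideanSpace ℝ ι) p, HasFDerivAt F F' x₀ ∧
      ∀ h, F' h = CAd.map (sumSndCLM ι) (Z (EuclideanSpace.sumEquivProd.symm (x₀, h))) := by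
  obtain ⟨L, hL, hlip⟩ := exists_memLp_lipschitz_eulerScheme (N := N) hℱ hW hT hμ hσ hp
  have hD : ∀ᵐ ω ∂P, HasFDerivAt (fun x => pathOf (eulerScheme T N μ σ W x) ω)
      (fderiv ℝ (fun x => pathOf (eulerScheme T N μ σ W x) ω) x₀) x₀ := by
    filter_upwards [hW.continuous_paths] with ω hω
    exact (differentiable_pathOf_eulerScheme hμ hσ hω x₀).hasFDerivAt
  have hlip' : ∀ᵐ ω ∂P, 0 ≤ L ω ∧ ∀ x, ‖pathOf (eulerScheme T N μ σ W x) ω -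
      pathOf (eulerScheme T N μ σ W x₀) ω‖ ≤ L ω * ‖x - x₀‖ := by
    filter_upwards [hlip] with ω h
    exact ⟨h.1, fun x => h.2 x x₀⟩
  exact CAd.exists_hasFDerivAt (f := fun x => pathOf (eulerScheme T N μ σ W x)) hp hL hF
    (map_sumSndCLM_ae_eq hW hμ hσ hZ x₀) hD hlip'

theorem map_sumFstCLM_eq [Fact (1 ≤ p)] (hW : IsWienerProcess P ℱ W)
    (hF : ∀ x, (F x).1 =ᵐ[P] pathOf (eulerScheme T N μ σ W x))
    (hZ : ∀ z, ∀ᵐ ω ∂P, ∀ t, EuclideanSpace.sumEquivProd (𝕜 := ℝ) ((Z z).1 ω t) =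
      augDeriv (fun x => eulerScheme T N μ σ W x t ω) (EuclideanSpace.sumEquivProd z))
    (z : EuclideanSpace ℝ (ι ⊕ ι)) :
    F (EuclideanSpace.sumEquivProd z).1 = CAd.map (sumFstCLM ι) (Z z) := by
  refine CAd.ext_ae ?_
  filter_upwards [hZ z, hF (EuclideanSpace.sumEquivProd z).1, CAd.coeFn_map (sumFstCLM ι) (Z z),
    hW.continuous_paths] with ω h1 h2 h3 hω t
  have h4 : (F (EuclideanSpace.sumEquivProd z).1).1 ω t =
      eulerScheme T N μ σ W (EuclideanSpace.sumEquivProd z).1 t ω := by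
    rw [h2, pathOf_apply (continuous_eulerScheme hω _)]
  refine h4.trans (Eq.symm ?_)
  exact (h3 t).trans (congrArg Prod.fst (h1 t))

theorem augDeriv_eq_prodEquiv [IsProbabilityMeasure P] [Fact (1 ≤ p)] (hp : p ≠ ∞)
    (hℱ : UsualConditions P ℱ) (hW : IsWienerProcess P ℱ W) (hT : 0 < T)
    (hμ : RegularCoefficient T μ) (hσ : RegularCoefficient T σ)
    (hF : ∀ x, (F x).1 =ᵐ[P] pathOf (eulerScheme T N μ σ W x))
    (hZ : ∀ z, ∀ᵐ ω ∂P, ∀ t, EuclideanSpace.sumEquivProd (𝕜 := ℝ) ((Z z).1 ω t) =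
      augDeriv (fun x => eulerScheme T N μ σ W x t ω) (EuclideanSpace.sumEquivProd z))
    (z : EuclideanSpace ℝ (ι ⊕ ι)) :
    augDeriv F (EuclideanSpace.sumEquivProd z) =
      CAd.prodEquiv EuclideanSpace.sumEquivProd (Z z) := by
  obtain ⟨F', hF', hFY⟩ :=
    exists_hasFDerivAt_eulerScheme hp hℱ hW hT hμ hσ hF hZ (EuclideanSpace.sumEquivProd z).1
  have h1 : fderiv ℝ F (EuclideanSpace.sumEquivProd z).1 (EuclideanSpace.sumEquivProd z).2 =
      CAd.map (sumSndCLM ι) (Z z) := by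
    rw [hF'.fderiv, hFY, Prod.mk.eta, ContinuousLinearEquiv.symm_apply_apply]
  exact Prod.ext (map_sumFstCLM_eq hW hF hZ z) h1

end AugmentedEulerDerivative

theorem mainTheorem7 {Ω : Type*} [mΩ : MeasurableSpace Ω] (P : Measure Ω)
    [IsProbabilityMeasure P] (ℱ : Filtration ℝ≥0 mΩ) (hℱ : UsualConditions P ℱ)
    (d : ℕ) (W : ℝ≥0 → Ω → EuclideanSpace ℝ (Fin d)) (hW : IsWienerProcess P ℱ W)
    (T : ℝ≥0) (hT : 1 ≤ T) (N : ℕ) (hN : 0 < N)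
    (μ : ℝ≥0 → EuclideanSpace ℝ (Fin d) → EuclideanSpace ℝ (Fin d))
    (σ : ℝ≥0 → EuclideanSpace ℝ (Fin d) → Matrix (Fin d) (Fin d) ℝ)
    (hμ : RegularCoefficient T μ) (hσ : RegularCoefficient T σ) :
    ∃ (h : ∀ x : EuclideanSpace ℝ (Fin d), MemEInf P ℱ (eulerScheme T N μ σ W x))
      (h' : ∀ z : EuclideanSpace ℝ (Fin d ⊕ Fin d),
        MemEInf P ℱ (eulerScheme T N (augDrift μ) (augDiffusion σ) W z)),
      ∀ (p : ℝ≥0∞) [Fact (1 ≤ p)] (hp : 2 ≤ p) (hp' : p ≠ ∞),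
        Differentiable ℝ (CAd.mkMap (eulerScheme T N μ σ W) h p hp hp') ∧
        ∀ z : EuclideanSpace ℝ (Fin d ⊕ Fin d),
          (CAd.prodEquiv EuclideanSpace.sumEquivProd).symm
              (augDeriv (CAd.mkMap (eulerScheme T N μ σ W) h p hp hp')
                (EuclideanSpace.sumEquivProd z)) =
            CAd.mkMap (eulerScheme T N (augDrift μ) (augDiffusion σ) W) h' p hp hp' z := by
  have hT0 : 0 < T := zero_lt_one.trans_le hT
  have h := fun x => hμ.memEInf_eulerScheme (N := N) hℱ hW hT0 hσ x
  have h' := fun z => memEInf_augmented_eulerScheme (N := N) hℱ hW hT0 hμ hσ z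
  -- The processes and their memberships are fixed before `p`, so the derivative is represented by
  -- the same process for every `p`.
  refine ⟨h, h', fun p _ hp hp' => ?_⟩
  have hF : ∀ x, (CAd.mkMap (eulerScheme T N μ σ W) h p hp hp' x).1 =ᵐ[P]
      pathOf (eulerScheme T N μ σ W x) := fun x => CAd.coeFn_mk _
  have hZ : ∀ z, ∀ᵐ ω ∂P, ∀ t, EuclideanSpace.sumEquivProd (𝕜 := ℝ)
      ((CAd.mkMap (eulerScheme T N (augDrift μ) (augDiffusion σ) W) h' p hp hp' z).1 ω t) =
      augDeriv (fun x => eulerScheme T N μ σ W x t ω) (EuclideanSpace.sumEquivProd z) := fun z =>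
    ae_sumEquivProd_augmented_eulerScheme hW hμ hσ z _
  refine ⟨fun x => ?_, fun z => ?_⟩
  · obtain ⟨F', hF', -⟩ := exists_hasFDerivAt_eulerScheme hp' hℱ hW hT0 hμ hσ hF hZ x
    exact hF'.differentiableAt
  · rw [ContinuousLinearEquiv.symm_apply_eq]
    exact augDeriv_eq_prodEquiv hp' hℱ hW hT0 hμ hσ hF hZ z
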